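/- Let $n\ge 1$. For $w\in\{0,1\}^{2n}$ let $w_L,w_R\in\{0,1\}^n$ be its first and last $n$ bits, and let $u*v$ denote concatenation. For $f:\{0,1\}^n\to\{0,1\}^n$ let $\mathsf{LR}[f]$ be the permutation of $\{0,1\}^{2n}$ given by $\mathsf{LR}[f](w)=w_R*(w_L\oplus f(w_R))$, and let $\mathsf{LR}^2[f]=\mathsf{LR}[f]\circ\mathsf{LR}[f]$. For a permutation $f$ of $\{0,1\}^n$ and keys $K_0,K_1,K_2\in\{0,1\}^{2n}$ the single-permutation two-round balanced permutations Even--Mansour cipher is the permutation of $\{0,1\}^{2n}$ $$\mathsf{BPEM}[K_0,K_1,K_2;f,f](w)=\mathsf{LR}^2[f]\bigl(\mathsf{LR}^2[f](w\oplus K_0)\oplus K_1\bigr)\oplus K_2 .$$ An adversary is a (possibly randomized, adaptive, computationally unbounded) algorithm $A$ that outputs a bit and has oracle access, in both the forward and the inverse direction, to a permutation $E$ of $\{0,1\}^{2n}$ and to a permutation $f$ of $\{0,1\}^n$. For integers $q_*,q\ge 0$, let $\Delta^{\mathrm{im\text{-}sprp}}_{\mathsf{BPEM}[K_0,K_1,K_2;f,f]}(q_*,q)$,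 the SPRP-advantage in the ideal model, be the supremum of $$\Bigl|\Pr\bigl[A^{(\mathsf{BPEM}[K_0,K_1,K_2;f,f],\,f)}=1\bigr]-\Pr\bigl[A^{(\Pi,\,f)}=1\bigr]\Bigr|$$ over all adversaries $A$ making at most $q_*$ queries to $E$ and at most $q$ queries to $f$ (both directions counted together in each case). Here $f$ is a uniformly random permutation of $\{0,1\}^n$, $K_0,K_1,K_2$ are uniform in $\{0,1\}^{2n}$, $\Pi$ is a uniformly random permutation of $\{0,1\}^{2n}$; $f,K_0,K_1,K_2$ are independent, and $\Pi$ is independent of $f$. Then for all integers $n\ge 1$ and $q_*,q\ge 0$, $$\Delta^{\mathrm{im\text{-}sprp}}_{\mathsf{BPEM}[K_0,K_1,K_2;f,f]}(q_*,q)\le\frac{q_*(21q_*+8q)}{2^n}.$$ -/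

import Mathlib

namespace BPEMCipher

open Equiv (Perm)

/-- Bit strings of length `n`, with bitwise XOR as the addition. -/
abbrev Bits (n : ℕ) : Type := Fin n → ZMod 2

/-- The first `n` bits of a string of length `2n`. -/
def left {n : ℕ} (w : Bits (n + n)) : Bits n := fun i => w (Fin.castAdd n i)

/-- The last `n` bits of a string of length `2n`. -/
def right {n : ℕ} (w : Bits (n + n)) : Bits n := fun i => w (Fin.natAdd n i)

/-- Concatenation of two strings of length `n`. -/
def concat {n : ℕ} (u v : Bits n) : Bits (n + n) := Fin.append u v

@[simp] theorem left_concat {n : ℕ} (u v : Bits n) : left (concat u v) = u := by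
  funext i; simp [left, concat]

@[simp] theorem right_concat {n : ℕ} (u v : Bits n) : right (concat u v) = v := by
  funext i; exact Fin.append_right u v i

@[simp] theorem concat_left_right {n : ℕ} (w : Bits (n + n)) : concat (left w) (right w) = w :=
  Fin.append_castAdd_natAdd

/-- In characteristic two, adding the same string twice does nothing. -/
theorem xor_xor {n : ℕ} (u v : Bits n) : u + v + v = u := by
  funext i
  simp only [Pi.add_apply]
  rw [add_assoc, CharTwo.add_self_eq_zero, add_zero]

/-- The Luby-Rackoff (Feistel) permutation `LR[f](w) = w_R * (w_L ⊕ f(w_R))` attached to an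
arbitrary function `f`. -/
def LR {n : ℕ} (f : Bits n → Bits n) : Perm (Bits (n + n)) where
  toFun w := concat (right w) (left w + f (right w))
  invFun w := concat (right w + f (left w)) (left w)
  left_inv w := by simp [xor_xor]
  right_inv w := by simp [xor_xor]

/-- The two-round Luby-Rackoff permutation `LR[f] ∘ LR[f]`. -/
def LR2 {n : ℕ} (f : Bits n → Bits n) : Perm (Bits (n + n)) := (LR f).trans (LR f)

/-- XOR with a key. -/
def xorPerm {m : ℕ} (K : Bits m) : Perm (Bits m) where
  toFun x := x + K
  invFun x := x + K
  left_inv x := xor_xor x K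
  right_inv x := xor_xor x K

/-- The `r`-round Even-Mansour cipher
`x ↦ P_r(… P_2(P_1(x ⊕ K_0) ⊕ K_1) …) ⊕ K_r`
(here `P i` is `P_{i+1}`, as `Fin r` starts at `0`). -/
def EM {m : ℕ} : (r : ℕ) → (Fin (r + 1) → Bits m) → (Fin r → Perm (Bits m)) → Perm (Bits m)
  | 0, K, _ => xorPerm (K 0)
  | r + 1, K, P =>
      ((EM r (fun i => K i.castSucc) (fun i => P i.castSucc)).trans (P (Fin.last r))).trans
        (xorPerm (K (Fin.last (r + 1))))

/-- The `r`-round balanced permutations Even-Mansour cipher `BPEM[K_0, …, K_r; f_1, …, f_r]`. -/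
def BPEM {n : ℕ} (r : ℕ) (K : Fin (r + 1) → Bits (n + n)) (f : Fin r → Perm (Bits n)) :
    Perm (Bits (n + n)) :=
  EM r K (fun i => LR2 (f i))

/-- A deterministic, adaptive, computationally unbounded distinguisher with oracle access, in both
directions, to a permutation of `{0,1}^m` (the cipher oracle) and to a permutation of `{0,1}^n`
(the public permutation): a finite decision tree that either outputs a bit or makes a query
and continues according to the answer. -/
inductive Strategy (m n : ℕ) : Type
  | output (b : Bool) : Strategy m n
  | enc (x : Bits m) (next : Bits m → Strategy m n) : Strategy m n
  | dec (y : Bits m) (next : Bits m → Strategy m n) : Strategy m n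
  | fwd (x : Bits n) (next : Bits n → Strategy m n) : Strategy m n
  | bwd (y : Bits n) (next : Bits n → Strategy m n) : Strategy m n

namespace Strategy

variable {m n : ℕ}

/-- The output of the interaction with cipher oracle `E` and public permutation `f`. -/
def run (E : Perm (Bits m)) (f : Perm (Bits n)) : Strategy m n → Bool
  | output b => b
  | enc x next => run E f (next (E x))
  | dec y next => run E f (next (E.symm y))
  | fwd x next => run E f (next (f x))
  | bwd y next => run E f (next (f.symm y))

/-- The number of encryption and decryption queries made during the interaction. -/
def cipherQueries (E : Perm (Bits m)) (f : Perm (Bits n)) : Strategy m n → ℕ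
  | output _ => 0
  | enc x next => cipherQueries E f (next (E x)) + 1
  | dec y next => cipherQueries E f (next (E.symm y)) + 1
  | fwd x next => cipherQueries E f (next (f x))
  | bwd y next => cipherQueries E f (next (f.symm y))

/-- The number of queries, in either direction, to the public permutation made during the
interaction. -/
def permQueries (E : Perm (Bits m)) (f : Perm (Bits n)) : Strategy m n → ℕ
  | output _ => 0
  | enc x next => permQueries E f (next (E x))
  | dec y next => permQueries E f (next (E.symm y))
  | fwd x next => permQueries E f (next (f x)) + 1
  | bwd y next => permQueries E f (next (f.symm y)) + 1

end Strategy

/-- A (randomized) adversary making at most `qc` queries to the cipher oracle and at most `q`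
queries to the public permutation, whatever permutations it interacts with: it draws its random
coins, that is a deterministic strategy, and then follows that strategy. (There are only countably
many strategies, so discrete distributions on them are fully general.) -/
structure Adversary (m n qc q : ℕ) where
  coins : PMF (Strategy m n)
  cipherQueries_le : ∀ s ∈ coins.support, ∀ (E : Perm (Bits m)) (f : Perm (Bits n)),
    s.cipherQueries E f ≤ qc
  permQueries_le : ∀ s ∈ coins.support, ∀ (E : Perm (Bits m)) (f : Perm (Bits n)),
    s.permQueries E f ≤ q

/-- `Pr[A^O = 1]`, where the oracles `(E, f)` are drawn from `O` independently of the coins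
of `A`. -/
noncomputable def Adversary.prOutputOne {m n qc q : ℕ} (A : Adversary m n qc q)
    (O : PMF (Perm (Bits m) × Perm (Bits n))) : ℝ :=
  ((A.coins.bind fun s => O.map fun o => s.run o.1 o.2) true).toReal

/-- The distinguishing advantage of `A`. -/
noncomputable def Adversary.advantage {m n qc q : ℕ} (A : Adversary m n qc q)
    (O O' : PMF (Perm (Bits m) × Perm (Bits n))) : ℝ :=
  |A.prOutputOne O - A.prOutputOne O'|

/-- The maximum distinguishing advantage over all adversaries with the given query bounds. -/
noncomputable def maxAdvantage {m n : ℕ} (O O' : PMF (Perm (Bits m) × Perm (Bits n)))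
    (qc q : ℕ) : ℝ :=
  ⨆ A : Adversary m n qc q, A.advantage O O'

/-- The real world: a uniform key `K` and an independent uniform public permutation `f`; the
oracles are `(C K f, f)`. -/
noncomputable def realWorld {κ : Type} [Fintype κ] [Nonempty κ] {m n : ℕ}
    (C : κ → Perm (Bits n) → Perm (Bits m)) : PMF (Perm (Bits m) × Perm (Bits n)) :=
  (PMF.uniformOfFintype κ).bind fun K =>
    (PMF.uniformOfFintype (Perm (Bits n))).map fun f => (C K f, f)

/-- The ideal world: independent uniform permutations of `{0,1}^m` and of `{0,1}^n`. -/
noncomputable def idealWorld (m n : ℕ) : PMF (Perm (Bits m) × Perm (Bits n)) :=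
  (PMF.uniformOfFintype (Perm (Bits m))).bind fun E =>
    (PMF.uniformOfFintype (Perm (Bits n))).map fun f => (E, f)

/-- The SPRP-advantage in the ideal model of a keyed construction `C` based on one
random permutation. -/
noncomputable def imSPRPAdvantage {κ : Type} [Fintype κ] [Nonempty κ] {m n : ℕ}
    (C : κ → Perm (Bits n) → Perm (Bits m)) (qc q : ℕ) : ℝ :=
  maxAdvantage (realWorld C) (idealWorld m n) qc q

theorem Adversary.advantage_le_one {m n qc q : ℕ} (A : Adversary m n qc q)
    (O O' : PMF (Perm (Bits m) × Perm (Bits n))) : A.advantage O O' ≤ 1 := by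
  have h : ∀ P : PMF (Perm (Bits m) × Perm (Bits n)), 0 ≤ A.prOutputOne P ∧ A.prOutputOne P ≤ 1 :=
    fun P => ⟨ENNReal.toReal_nonneg, ENNReal.toReal_mono ENNReal.one_ne_top (PMF.coe_le_one _ _)⟩
  have h1 := h O
  have h2 := h O'
  exact abs_le.2 ⟨by linarith, by linarith⟩

/-- The supremum defining `maxAdvantage` is a genuine one: every advantage is below it. -/
theorem Adversary.advantage_le_max {m n qc q : ℕ} (A : Adversary m n qc q)
    (O O' : PMF (Perm (Bits m) × Perm (Bits n))) : A.advantage O O' ≤ maxAdvantage O O' qc q :=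
  le_ciSup (f := fun B : Adversary m n qc q => B.advantage O O')
    ⟨1, by rintro _ ⟨B, rfl⟩; exact B.advantage_le_one O O'⟩ A

/-- There are adversaries for all query bounds. -/
instance {m n qc q : ℕ} : Nonempty (Adversary m n qc q) :=
  ⟨{ coins := PMF.pure (Strategy.output true)
     cipherQueries_le := by
       intro s hs E f
       rw [PMF.support_pure, Set.mem_singleton_iff] at hs
       subst hs
       exact Nat.zero_le _
     permQueries_le := by
       intro s hs E f
       rw [PMF.support_pure, Set.mem_singleton_iff] at hs
       subst hs
       exact Nat.zero_le _ }⟩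

end BPEMCipher

/-! The proof is an H-coefficient argument. Write `N` for `2 ^ n`, and `p`, `q` for the bounds on
cipher queries and on queries to `f`. A transcript is a set of recorded cipher pairs together with a
set of recorded pairs of `f`. If good transcripts are almost as likely in the real world as in the
ideal one, and the ideal world rarely produces a bad one, then no output bit is much rarer in the
real world. Applied to both bits, this bounds the advantage.

Split a cipher pair into halves, masked by the outer keys: input `(a, b)`, output `(s, t)`; let `(k,
k')` be the middle key. The cipher joins input to output when `f` sends `a + f b` to `t + f s + b +
k'` and `t + f s` to `a + f b + s + k` (`Connects`). Condition on `f` at the recorded points and at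
the outer points `b`, `s`. Unless some coincidence occurs (`HalfBad`), the inner conditions
prescribe two fresh values at two fresh points for each pair, so they hold with probability at least
`N ^ (-2p)`. This is close to the ideal probability of the recorded cipher pairs, since a random
permutation of `N ^ 2` points behaves almost like a random function.

Coincidences are rare because a key half randomizes the point or value concerned, or because `f` is
random at two distinct outer points. The exception is a pair of queries with the same `b` (or the
same `s`), where the `f` terms cancel. Distinctness of the queries excludes equal inner points, and
`GoodTranscript` excludes equal inner values.

The losses are `(6pq + 17p²)/N` for coincidences (`card_mul_card_le_connects`), `p²/N` for comparing
permutation and function, and `2p/N` per cipher query for bad transcripts: in total `(6pq +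
20p²)/N`. The induction over the adversary is `mass_run_le`. -/

namespace BPEMCipher

open Equiv (Perm)
open Finset

/-! ### Counting permutations with prescribed values -/

section Counting

variable {α : Type*} [Fintype α] [DecidableEq α]

/-- The permutation `f` maps `e.1` to `e.2` for every pair `e` of `Q`. -/
def Agrees (f : Perm α) (Q : Finset (α × α)) : Prop := ∀ e ∈ Q, f e.1 = e.2

instance (f : Perm α) (Q : Finset (α × α)) : Decidable (Agrees f Q) :=
  inferInstanceAs (Decidable (∀ e ∈ Q, f e.1 = e.2))

omit [Fintype α] in
theorem agrees_insert {f : Perm α} {Q : Finset (α × α)} {x y : α} :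
    Agrees f (insert (x, y) Q) ↔ f x = y ∧ Agrees f Q := by
  simp [Agrees]

/-- The permutations that agree with `Q`. -/
def agreeing (Q : Finset (α × α)) : Finset (Perm α) := univ.filter fun f => Agrees f Q

@[simp] theorem mem_agreeing {Q : Finset (α × α)} {f : Perm α} :
    f ∈ agreeing Q ↔ Agrees f Q := by simp [agreeing]

theorem card_agreeing_eq_sum (Q : Finset (α × α)) (x : α) :
    #(agreeing Q) = ∑ y, #(agreeing (insert (x, y) Q)) := by
  rw [card_eq_sum_card_fiberwise (f := fun f : Perm α => f x) (t := univ) (by simp)]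
  refine sum_congr rfl fun y _ => ?_
  congr 1
  ext f
  simp [agrees_insert, and_comm]

/-- Composing with the transposition of `y` and `z` redirects `x` to `z`. It leaves the values in
`Q` alone: they differ from `y` by injectivity of `f`, and from `z` by hypothesis. -/
theorem card_agreeing_insert_le {Q : Finset (α × α)} {x y z : α} (hx : ∀ e ∈ Q, e.1 ≠ x)
    (hz : ∀ e ∈ Q, e.2 ≠ z) :
    #(agreeing (insert (x, y) Q)) ≤ #(agreeing (insert (x, z) Q)) := by
  refine card_le_card_of_injOn (fun f => Equiv.swap y z * f) ?_
    ((mul_right_injective _).injOn)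
  intro f hf
  simp only [mem_coe, mem_agreeing, agrees_insert] at hf ⊢
  refine ⟨by simp [hf.1], fun e he => ?_⟩
  have h1 : f e.1 = e.2 := hf.2 e he
  have h2 : e.2 ≠ y := by
    rw [← h1, ← hf.1]
    exact fun h => hx e he (f.injective h)
  rw [Perm.mul_apply, h1, Equiv.swap_apply_of_ne_of_ne h2 (hz e he)]

/-- Each of the at least `|α| - #Q` unused values `z` is at least as frequent an image of `x` as `y`
is. The value `y` itself need not be unused. -/
theorem sub_mul_card_agreeing_insert_le {Q : Finset (α × α)} {x : α} (y : α)
    (hx : ∀ e ∈ Q, e.1 ≠ x) :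
    (Fintype.card α - #Q) * #(agreeing (insert (x, y) Q)) ≤ #(agreeing Q) := by
  rw [card_agreeing_eq_sum Q x]
  calc _ ≤ #((Q.image Prod.snd)ᶜ) * #(agreeing (insert (x, y) Q)) := by
        rw [card_compl]
        gcongr
        exact card_image_le
    _ = ∑ z ∈ (Q.image Prod.snd)ᶜ, #(agreeing (insert (x, y) Q)) := by simp
    _ ≤ ∑ z ∈ (Q.image Prod.snd)ᶜ, #(agreeing (insert (x, z) Q)) := by
        refine sum_le_sum fun z hz => card_agreeing_insert_le hx fun e he h => ?_
        exact mem_compl.1 hz (mem_image.2 ⟨e, he, h⟩)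
    _ ≤ _ := sum_le_sum_of_subset (subset_univ _)

theorem pow_mul_card_agreeing_le (Q : Finset (α × α)) :
    (Fintype.card α - #Q) ^ #Q * #(agreeing Q) ≤ Fintype.card (Perm α) := by
  induction Q using Finset.induction_on with
  | empty => simpa using card_le_univ _
  | insert e Q he ih =>
    obtain ⟨x, y⟩ := e
    rcases (agreeing (insert (x, y) Q)).eq_empty_or_nonempty with h | ⟨f, hf⟩
    · simp [h]
    rw [mem_agreeing, agrees_insert] at hf
    have hx : ∀ e ∈ Q, e.1 ≠ x := by
      rintro e h1 rfl
      have h2 := hf.2 e h1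
      rw [hf.1] at h2
      subst h2
      exact he h1
    have hc := sub_mul_card_agreeing_insert_le y hx
    rw [card_insert_of_notMem he, pow_succ, mul_assoc]
    calc _ ≤ (Fintype.card α - #Q) ^ #Q * ((Fintype.card α - #Q) *
          #(agreeing (insert (x, y) Q))) := by gcongr <;> omega
      _ ≤ _ := (Nat.mul_le_mul_left _ hc).trans ih

/-- The old value `f x` and the corrected permutation together determine `f`. -/
theorem card_le_card_mul_filter_swap (F : Finset (Perm α)) (x y : α)
    (hF : ∀ f ∈ F, Equiv.swap (f x) y * f ∈ F) :
    #F ≤ Fintype.card α * #(F.filter fun f => f x = y) := by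
  rw [← card_univ, ← card_product]
  refine card_le_card_of_injOn (fun f => (f x, Equiv.swap (f x) y * f)) ?_ ?_
  · intro f hf
    simpa using hF f hf
  · intro f _ g _ h
    simp only [Prod.mk.injEq] at h
    rw [h.1] at h
    exact mul_right_injective _ h.2

/-- Prescribing `k` new values, at new points, for a permutation that is already prescribed on `D`
divides the number of permutations by at most `|α| ^ k`. -/
theorem card_le_pow_mul_card_prescribed {J : Type*} [DecidableEq J] (D : Finset α) (g : Perm α)
    (X Y : J → α) (hX : X.Injective) (hY : Y.Injective) (hXD : ∀ j, X j ∉ D)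
    (hYD : ∀ j, Y j ∉ D.image g) (s : Finset J) :
    #(univ.filter fun f : Perm α => ∀ x ∈ D, f x = g x) ≤ Fintype.card α ^ #s *
      #(univ.filter fun f : Perm α => (∀ x ∈ D, f x = g x) ∧ ∀ j ∈ s, f (X j) = Y j) := by
  induction s using Finset.induction_on with
  | empty => simp
  | insert i s hi ih =>
    refine ih.trans ?_
    rw [card_insert_of_notMem hi, pow_succ, mul_assoc]
    refine Nat.mul_le_mul_left _ ((card_le_card_mul_filter_swap _ (X i) (Y i) ?_).trans ?_)
    · intro f hf
      simp only [mem_filter, mem_univ, true_and] at hf ⊢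
      refine ⟨fun x hx => ?_, fun j hj => ?_⟩
      · rw [Perm.mul_apply, Equiv.swap_apply_of_ne_of_ne, hf.1 x hx]
        · exact fun h => hXD i (f.injective h ▸ hx)
        · rw [hf.1 x hx]
          exact fun h => hYD i (mem_image.2 ⟨x, hx, h⟩)
      · have hji : j ≠ i := fun h => hi (h ▸ hj)
        rw [Perm.mul_apply, Equiv.swap_apply_of_ne_of_ne, hf.2 j hj]
        · exact fun h => hji (hX (f.injective h))
        · rw [hf.2 j hj]
          exact fun h => hji (hY h)
    · refine Nat.mul_le_mul_left _ (card_le_card fun f hf => ?_)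
      simp only [mem_filter, mem_univ, true_and, mem_insert, forall_eq_or_imp] at hf ⊢
      exact ⟨hf.1.1, hf.2, hf.1.2⟩

end Counting

/-! ### Randomness from `f` and from the keys -/

section Group

variable {G : Type*} [AddCommGroup G] [Fintype G] [DecidableEq G]

/-- Once `f b'` is fixed, the condition prescribes `f b` at a point still unqueried; the extra `1`
accounts for the pair recording `f b'`. -/
theorem sub_mul_card_collision_le {Q : Finset (G × G)} {b b' : G} (hb : ∀ e ∈ Q, e.1 ≠ b)
    (hne : b' ≠ b) (c : G) :
    (Fintype.card G - (#Q + 1)) * #((agreeing Q).filter fun f => f b - f b' = c) ≤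
      #(agreeing Q) := by
  rw [card_eq_sum_card_fiberwise (f := fun f : Perm G => f b') (t := univ) (by simp),
    card_agreeing_eq_sum Q b', mul_sum]
  refine sum_le_sum fun z _ => ?_
  refine le_trans ?_ (sub_mul_card_agreeing_insert_le (x := b) (c + z) ?_)
  · refine Nat.mul_le_mul (Nat.sub_le_sub_left (card_insert_le _ _) _)
      (card_le_card fun f hf => ?_)
    simp only [mem_filter, mem_agreeing, agrees_insert] at hf ⊢
    obtain ⟨⟨h1, h2⟩, rfl⟩ := hf
    exact ⟨sub_eq_iff_eq_add.1 h2, rfl, h1⟩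
  · simp only [mem_insert, forall_eq_or_imp]
    exact ⟨hne, hb⟩

omit [DecidableEq G] in
/-- If rerandomizing the `j`-th key leaves at most `M` bad choices, then the bad event has
probability at most `M / |G|`. -/
theorem card_mul_card_filter_le {m : ℕ} {β : Type*} (j : Fin m) (F : Finset β)
    (φ : (Fin m → G) → β → Prop) [∀ κ f, Decidable (φ κ f)] (M : ℕ)
    (h : ∀ κ : Fin m → G, ∀ f ∈ F, #(univ.filter fun v => φ (κ + Pi.single j v) f) ≤ M) :
    Fintype.card G * #((univ ×ˢ F).filter fun o : (Fin m → G) × β => φ o.1 o.2) ≤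
      M * #((univ : Finset (Fin m → G)) ×ˢ F) := by
  have key : ∀ v : G, #((univ ×ˢ F).filter fun o : (Fin m → G) × β => φ o.1 o.2) =
      ∑ o ∈ (univ : Finset (Fin m → G)) ×ˢ F,
        if φ (o.1 + Pi.single j v) o.2 then 1 else 0 := by
    intro v
    rw [card_filter, sum_product_right, sum_product_right]
    refine sum_congr rfl fun f _ => ?_
    exact (Equiv.sum_comp (Equiv.addRight (Pi.single j v : Fin m → G))
      (fun κ => if φ κ f then 1 else 0)).symm
  calc _ = ∑ v : G, #((univ ×ˢ F).filter fun o : (Fin m → G) × β => φ o.1 o.2) := by simp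
    _ = ∑ o ∈ (univ : Finset (Fin m → G)) ×ˢ F,
        ∑ v, if φ (o.1 + Pi.single j v) o.2 then 1 else 0 := by
        rw [sum_congr rfl fun v _ => key v, sum_comm]
    _ ≤ ∑ o ∈ (univ : Finset (Fin m → G)) ×ˢ F, M := by
        refine sum_le_sum fun o ho => ?_
        rw [← card_filter]
        exact h o.1 o.2 (mem_product.1 ho).2
    _ = _ := by rw [sum_const, smul_eq_mul, mul_comm]

theorem card_exists_add_mem_le {ι : Type*} [Fintype ι] (c : ι → G) (W : Finset G) :
    #(univ.filter fun v => ∃ i, c i + v ∈ W) ≤ Fintype.card ι * #W := by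
  calc _ ≤ #(univ.biUnion fun i => W.image fun w => w - c i) := by
        refine card_le_card fun v hv => ?_
        obtain ⟨i, hi⟩ := (mem_filter.1 hv).2
        exact mem_biUnion.2 ⟨i, mem_univ _, mem_image.2 ⟨_, hi, by simp⟩⟩
    _ ≤ _ := card_biUnion_le_card_mul _ _ _ fun i _ => card_image_le

end Group

/-! ### Probability that all recorded pairs are connected -/

section Core

variable {G : Type*} [AddCommGroup G] [Fintype G] [DecidableEq G]
variable {ι : Type*} [Fintype ι] [DecidableEq ι]

/-- The inputs of the outer rounds together with the already queried points `P`. -/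
def outerPoints (P : Finset G) (b s : ι → G) : Finset G := P ∪ (univ.image b ∪ univ.image s)

/-- The failure events, for one half of a two-round Feistel composition, that prevent the inner
evaluations of `f` from being at fresh points with fresh values. -/
def HalfBad (P : Finset G) (f : Perm G) (a b s t : ι → G) (k k' : G) : Prop :=
  (∃ i, b i ∈ P) ∨
  (∃ i, a i + f (b i) ∈ outerPoints P b s ∪ univ.image fun j => t j + f (s j)) ∨
  (∃ i, a i + f (b i) + s i + k ∈
    (outerPoints P b s).image f ∪ univ.image fun j => t j + f (s j) + b j + k') ∨
  ∃ i j, i ≠ j ∧ (a i + f (b i) = a j + f (b j) ∨ a i + f (b i) + s i = a j + f (b j) + s j)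

omit [AddCommGroup G] [Fintype G] [DecidableEq ι] in
theorem card_outerPoints_le (P : Finset G) (b s : ι → G) :
    #(outerPoints P b s) ≤ #P + 2 * Fintype.card ι := by
  have h1 : #(univ.image b) ≤ Fintype.card ι := card_image_le
  have h2 : #(univ.image s) ≤ Fintype.card ι := card_image_le
  have h3 := card_union_le P (univ.image b ∪ univ.image s)
  have h4 := card_union_le (univ.image b) (univ.image s)
  unfold outerPoints
  omega

omit [AddCommGroup G] [Fintype G] [DecidableEq ι] in
theorem card_union_image_le (W : Finset G) (c : ι → G) :
    #(W ∪ univ.image c) ≤ #W + Fintype.card ι :=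
  (card_union_le _ _).trans (Nat.add_le_add_left card_image_le _)

open Classical in
-- Hypothesis `hQ` turns the collision probability `1 / (|G| - #Q - 1)` into `5 / (4|G|)`, which is
-- where the factors 4 and 5 come from.
theorem card_collision_le {β : Type*} [Fintype β] (Q : Finset (G × G))
    (hQ : 4 * Fintype.card G ≤ 5 * (Fintype.card G - (#Q + 1))) (b b' c : β → G) :
    4 * Fintype.card G * #(((univ : Finset β) ×ˢ agreeing Q).filter fun o =>
      b o.1 ∉ Q.image Prod.fst ∧ b' o.1 ≠ b o.1 ∧ o.2 (b o.1) - o.2 (b' o.1) = c o.1) ≤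
    5 * #((univ : Finset β) ×ˢ agreeing Q) := by
  rw [card_filter, sum_product, card_product, mul_sum]
  have h : ∀ κ : β, 4 * Fintype.card G * (∑ f ∈ agreeing Q,
      if b κ ∉ Q.image Prod.fst ∧ b' κ ≠ b κ ∧ f (b κ) - f (b' κ) = c κ then 1 else 0) ≤
      5 * #(agreeing Q) := by
    intro κ
    by_cases h1 : b κ ∈ Q.image Prod.fst
    · simp [h1]
    by_cases h2 : b' κ ≠ b κ
    swap
    · simp [h2]
    simp only [h1, h2, not_false_eq_true, true_and, ne_eq]
    rw [← card_filter]
    refine (Nat.mul_le_mul_right _ hQ).trans ?_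
    rw [mul_assoc]
    refine Nat.mul_le_mul_left _ (sub_mul_card_collision_le ?_ h2 _)
    exact fun e he h => h1 (mem_image.2 ⟨e, he, h⟩)
  calc _ ≤ ∑ κ : β, 5 * #(agreeing Q) := sum_le_sum fun κ _ => h κ
    _ = _ := by rw [sum_const, smul_eq_mul, card_univ]; ring

omit [DecidableEq ι] in
open Classical in
-- A union bound. With `p = |ι|`, the four clauses contribute `p #Q`, `p (#Q + 3p)`, `p (#Q + 3p)`
-- and twice `5p²/4`, all over `|G|`; clearing the denominator 4 gives 12 and 34. The permutation
-- `σ` of the key halves lets the same bound serve both halves of the cipher.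
theorem card_halfBad_le (A B S T : ι → G) (σ : Perm (Fin 6)) (Q : Finset (G × G))
    (hQ : 4 * Fintype.card G ≤ 5 * (Fintype.card G - (#Q + 1)))
    (hA : ∀ i j, i ≠ j → B i = B j → A i ≠ A j)
    (hAS : ∀ i j, i ≠ j → B i = B j → A i + S i ≠ A j + S j) :
    4 * Fintype.card G * #(((univ : Finset (Fin 6 → G)) ×ˢ agreeing Q).filter fun o =>
      HalfBad (Q.image Prod.fst) o.2 (fun i => A i + o.1 (σ 0)) (fun i => B i + o.1 (σ 1))
        (fun i => S i + o.1 (σ 2)) (fun i => T i + o.1 (σ 3)) (o.1 (σ 4)) (o.1 (σ 5))) ≤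
    (12 * Fintype.card ι * #Q + 34 * Fintype.card ι ^ 2) *
      #((univ : Finset (Fin 6 → G)) ×ˢ agreeing Q) := by
  set p := Fintype.card ι with hp
  set P := Q.image Prod.fst with hP
  have hPQ : #P ≤ #Q := card_image_le
  have hσ : ∀ x y : Fin 6, (σ x = σ y) = (x = y) := fun x y => propext σ.injective.eq_iff
  set Ω := (univ : Finset (Fin 6 → G)) ×ˢ agreeing Q with hΩ
  set φ1 : (Fin 6 → G) → Perm G → Prop := fun κ f => ∃ i, B i + κ (σ 1) ∈ P
  set φ2 : (Fin 6 → G) → Perm G → Prop := fun κ f => ∃ i, A i + κ (σ 0) + f (B i + κ (σ 1)) ∈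
    outerPoints P (fun i => B i + κ (σ 1)) (fun i => S i + κ (σ 2)) ∪
      univ.image fun j => T j + κ (σ 3) + f (S j + κ (σ 2))
  set φ3 : (Fin 6 → G) → Perm G → Prop := fun κ f =>
    ∃ i, A i + κ (σ 0) + f (B i + κ (σ 1)) + (S i + κ (σ 2)) + κ (σ 4) ∈
    (outerPoints P (fun i => B i + κ (σ 1)) (fun i => S i + κ (σ 2))).image f ∪
      univ.image fun j => T j + κ (σ 3) + f (S j + κ (σ 2)) + (B j + κ (σ 1)) + κ (σ 5)
  set C : ι × ι → (ι → G) → Finset ((Fin 6 → G) × Perm G) := fun z c => Ω.filter fun o =>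
    B z.1 + o.1 (σ 1) ∉ P ∧ B z.2 + o.1 (σ 1) ≠ B z.1 + o.1 (σ 1) ∧
      o.2 (B z.1 + o.1 (σ 1)) - o.2 (B z.2 + o.1 (σ 1)) = c z.2 - c z.1 with hC
  -- Each of the first three events is controlled by a key half that shifts the tested element but
  -- not the target set: the masks of `b` and of `a`, and then the middle key `k`.
  have h1 : Fintype.card G * #(Ω.filter fun o => φ1 o.1 o.2) ≤ p * #Q * #Ω := by
    refine card_mul_card_filter_le (σ 1) _ φ1 _ fun κ f _ => ?_
    refine le_trans (le_of_eq ?_) ((card_exists_add_mem_le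
      (fun i => B i + κ (σ 1)) P).trans (Nat.mul_le_mul_left _ hPQ))
    congr! 3 with v
    simp [add_assoc]
  have hD := fun κ : Fin 6 → G =>
    card_outerPoints_le P (fun i => B i + κ (σ 1)) (fun i => S i + κ (σ 2))
  have h2 : Fintype.card G * #(Ω.filter fun o => φ2 o.1 o.2) ≤ p * (#Q + 3 * p) * #Ω := by
    refine card_mul_card_filter_le (σ 0) _ φ2 _ fun κ f _ => ?_
    refine le_trans (le_of_eq ?_) ((card_exists_add_mem_le
      (fun i => A i + κ (σ 0) + f (B i + κ (σ 1)))
      (outerPoints P (fun i => B i + κ (σ 1)) (fun i => S i + κ (σ 2)) ∪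
        univ.image fun j => T j + κ (σ 3) + f (S j + κ (σ 2)))).trans
        (Nat.mul_le_mul_left _ ((card_union_image_le _ _).trans ?_)))
    · congr! 3 with v
      simp only [Pi.add_apply, Pi.single_apply, hσ]
      simp [add_assoc, add_comm, add_left_comm]
    · have := hD κ
      omega
  have h3 : Fintype.card G * #(Ω.filter fun o => φ3 o.1 o.2) ≤ p * (#Q + 3 * p) * #Ω := by
    refine card_mul_card_filter_le (σ 4) _ φ3 _ fun κ f _ => ?_
    refine le_trans (le_of_eq ?_) ((card_exists_add_mem_le
      (fun i => A i + κ (σ 0) + f (B i + κ (σ 1)) + (S i + κ (σ 2)) + κ (σ 4))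
      ((outerPoints P (fun i => B i + κ (σ 1)) (fun i => S i + κ (σ 2))).image f ∪
        univ.image fun j => T j + κ (σ 3) + f (S j + κ (σ 2)) + (B j + κ (σ 1)) + κ (σ 5))).trans
        (Nat.mul_le_mul_left _ ((card_union_image_le _ _).trans ?_)))
    · congr! 3 with v
      simp only [Pi.add_apply, Pi.single_apply, hσ]
      simp [add_assoc]
    · have := hD κ
      have h4 : #((outerPoints P (fun i => B i + κ (σ 1)) (fun i => S i + κ (σ 2))).image f) ≤ _ :=
        card_image_le
      omega
  have h4 : ∀ z c, 4 * Fintype.card G * #(C z c) ≤ 5 * #Ω := fun z c =>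
    card_collision_le Q hQ (fun κ : Fin 6 → G => B z.1 + κ (σ 1)) (fun κ => B z.2 + κ (σ 1))
      (fun _ => c z.2 - c z.1)
  have hsum : ∀ c, 4 * Fintype.card G * ∑ z, #(C z c) ≤ 5 * p ^ 2 * #Ω := by
    intro c
    rw [mul_sum]
    refine (sum_le_sum fun z _ => h4 z c).trans (le_of_eq ?_)
    rw [sum_const, smul_eq_mul, card_univ, Fintype.card_prod]
    ring
  have hs1 := hsum A
  have hs2 := hsum (fun i => A i + S i)
  have hsub : (Ω.filter fun o =>
      HalfBad P o.2 (fun i => A i + o.1 (σ 0)) (fun i => B i + o.1 (σ 1))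
        (fun i => S i + o.1 (σ 2)) (fun i => T i + o.1 (σ 3)) (o.1 (σ 4)) (o.1 (σ 5))) ⊆
      (Ω.filter fun o => φ1 o.1 o.2) ∪ (Ω.filter fun o => φ2 o.1 o.2) ∪
        (Ω.filter fun o => φ3 o.1 o.2) ∪
        ((univ.biUnion fun z => C z A) ∪ univ.biUnion fun z => C z fun i => A i + S i) := by
    rintro ⟨κ, f⟩ ho
    obtain ⟨ho, hbad⟩ := mem_filter.1 ho
    by_cases hb : φ1 κ f
    · simp only [mem_union, mem_filter, ho, hb, true_and, true_or]
    rcases hbad with h | h | h | ⟨i, j, hij, h⟩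
    · exact absurd h hb
    · have h' : φ2 κ f := h
      simp only [mem_union, mem_filter, ho, h', true_and, true_or, or_true]
    · have h' : φ3 κ f := h
      simp only [mem_union, mem_filter, ho, h', true_and, true_or, or_true]
    -- For distinct outer inputs this is a collision of `f` at an unqueried point. For equal ones
    -- the `f` terms cancel, and `hA` or `hAS` applies.
    · have hbi : B i + κ (σ 1) ∉ P := fun h => hb ⟨i, h⟩
      refine mem_union_right _ ?_
      rcases h with h | h
      · refine mem_union_left _ (mem_biUnion.2 ⟨(i, j), mem_univ _, mem_filter.2
          ⟨ho, hbi, fun h' => ?_, ?_⟩⟩)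
        · have hB : B i = B j := (add_right_cancel h').symm
          simp only [hB] at h
          exact hA i j hij hB (add_right_cancel (add_right_cancel h))
        · dsimp only at h ⊢
          rw [← sub_eq_zero] at h ⊢
          rw [← h]
          abel
      · refine mem_union_right _ (mem_biUnion.2 ⟨(i, j), mem_univ _, mem_filter.2
          ⟨ho, hbi, fun h' => ?_, ?_⟩⟩)
        · have hB : B i = B j := (add_right_cancel h').symm
          simp only [hB] at h
          refine hAS i j hij hB ?_
          rw [← sub_eq_zero] at h ⊢
          rw [← h]
          abel
        · dsimp only at h ⊢
          rw [← sub_eq_zero] at h ⊢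
          rw [← h]
          abel
  have hcard := (card_le_card hsub).trans ((card_union_le _ _).trans (Nat.add_le_add
    ((card_union_le _ _).trans (Nat.add_le_add_right (card_union_le _ _) _))
    ((card_union_le _ _).trans (Nat.add_le_add card_biUnion_le card_biUnion_le))))
  refine (Nat.mul_le_mul_left _ hcard).trans ?_
  nlinarith [h1, h2, h3, hs1, hs2]

/-- The inner evaluations of `f` connect the two ends of all the given input-output pairs. -/
def Connects (f : Perm G) (a b s t : ι → G) (k k' : G) : Prop :=
  ∀ i, f (a i + f (b i)) = t i + f (s i) + b i + k' ∧ f (t i + f (s i)) = a i + f (b i) + s i + k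

open Classical in
-- Group the permutations by their restriction to the outer points. The failure events depend only
-- on this restriction, so if a class contains one permutation `g` without failure, the inner points
-- and required values computed from `g` are the same throughout the class. They are distinct and
-- fresh, and prescribing them costs a factor of at most `|G|` each.
theorem card_not_halfBad_le (a b s t : ι → G) (k k' : G) (Q : Finset (G × G)) :
    #((agreeing Q).filter fun f => ¬ HalfBad (Q.image Prod.fst) f a b s t k k' ∧
      ¬ HalfBad (Q.image Prod.fst) f t s b a k' k) ≤
    Fintype.card G ^ (2 * Fintype.card ι) *
      #((agreeing Q).filter fun f => Connects f a b s t k k') := by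
  set P := Q.image Prod.fst with hP
  set D := outerPoints P b s with hD
  have hD' : outerPoints P s b = D := by
    rw [hD, outerPoints, outerPoints, union_comm (univ.image s)]
  have hPD : ∀ x ∈ P, x ∈ D := fun x hx => mem_union_left _ hx
  have hbD : ∀ i, b i ∈ D := fun i =>
    mem_union_right _ (mem_union_left _ (mem_image_of_mem _ (mem_univ i)))
  have hsD : ∀ i, s i ∈ D := fun i =>
    mem_union_right _ (mem_union_right _ (mem_image_of_mem _ (mem_univ i)))
  set r : Perm G → D → G := fun f x => f x with hr
  rw [card_eq_sum_card_fiberwise (f := r) (t := univ) (by simp),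
    card_eq_sum_card_fiberwise (s := (agreeing Q).filter fun f => Connects f a b s t k k')
      (f := r) (t := univ) (by simp), mul_sum]
  refine sum_le_sum fun ρ _ => ?_
  rcases Finset.eq_empty_or_nonempty (((agreeing Q).filter fun f =>
    ¬ HalfBad P f a b s t k k' ∧ ¬ HalfBad P f t s b a k' k).filter fun f => r f = ρ)
    with h | ⟨g, hg⟩
  · rw [h]
    simp
  simp only [mem_filter, mem_agreeing] at hg
  obtain ⟨⟨hgQ, hg1, hg2⟩, rfl⟩ := hg
  simp only [HalfBad, not_or, not_exists, not_and] at hg1 hg2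
  obtain ⟨-, hg3, hg4, hg5⟩ := hg1
  obtain ⟨-, hg6, hg7, hg8⟩ := hg2
  rw [hD'] at hg6 hg7
  simp only [← hD, mem_union, not_or, mem_image, not_exists, mem_univ, true_and, not_and]
    at hg3 hg4 hg6 hg7
  have hext := card_le_pow_mul_card_prescribed (J := ι ⊕ ι) D g
    (Sum.elim (fun i => a i + g (b i)) fun i => t i + g (s i))
    (Sum.elim (fun i => t i + g (s i) + b i + k') fun i => a i + g (b i) + s i + k)
    (Function.Injective.sumElim
      (fun i j h => by_contra fun hij => (hg5 i j hij).1 h)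
      (fun i j h => by_contra fun hij => (hg8 i j hij).1 h)
      (fun i j h => (hg3 i).2 j h.symm))
    (Function.Injective.sumElim
      (fun i j h => by_contra fun hij => (hg8 i j hij).2 (add_right_cancel h))
      (fun i j h => by_contra fun hij => (hg5 i j hij).2 (add_right_cancel h))
      (fun i j h => (hg4 j).2 i h))
    (by rintro (i | i); exacts [(hg3 i).1, (hg6 i).1])
    (by
      rintro (i | i) h
      · obtain ⟨x, hx, h⟩ := mem_image.1 h
        exact (hg7 i).1 x hx h
      · obtain ⟨x, hx, h⟩ := mem_image.1 h
        exact (hg4 i).1 x hx h)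
    univ
  rw [card_univ, Fintype.card_sum, ← two_mul] at hext
  have hrg : ∀ f : Perm G, r f = r g ↔ ∀ x ∈ D, f x = g x := fun f => by
    simp [hr, funext_iff]
  refine le_trans (card_le_card fun f hf => ?_)
    (hext.trans (Nat.mul_le_mul_left _ (card_le_card fun f hf => ?_)))
  · simp only [mem_filter, hrg, mem_univ, true_and] at hf ⊢
    exact hf.2
  · simp only [mem_filter, mem_univ, true_and, forall_const, Sum.forall, Sum.elim_inl,
      Sum.elim_inr] at hf
    obtain ⟨h1, h2, h3⟩ := hf
    simp only [mem_filter, hrg, mem_agreeing]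
    refine ⟨⟨fun e he => ?_, fun i => ?_⟩, h1⟩
    · rw [h1 _ (hPD _ (mem_image_of_mem _ he)), hgQ e he]
    · rw [h1 _ (hbD i), h1 _ (hsD i)]
      exact ⟨h2 i, h3 i⟩

open Classical in
/-- The number of keys and permutations for which all given input-output pairs are connected. -/
theorem card_mul_card_le_connects (A B S T : ι → G) (Q : Finset (G × G))
    (hQ : 4 * Fintype.card G ≤ 5 * (Fintype.card G - (#Q + 1)))
    (hA : ∀ i j, i ≠ j → B i = B j → A i ≠ A j)
    (hT : ∀ i j, i ≠ j → S i = S j → T i ≠ T j)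
    (hAS : ∀ i j, i ≠ j → B i = B j → A i + S i ≠ A j + S j)
    (hTB : ∀ i j, i ≠ j → S i = S j → T i + B i ≠ T j + B j) :
    Fintype.card G * #((univ : Finset (Fin 6 → G)) ×ˢ agreeing Q) ≤
      Fintype.card G * (Fintype.card G ^ (2 * Fintype.card ι) *
        #(((univ : Finset (Fin 6 → G)) ×ˢ agreeing Q).filter fun o =>
          Connects o.2 (fun i => A i + o.1 0) (fun i => B i + o.1 1) (fun i => S i + o.1 2)
            (fun i => T i + o.1 3) (o.1 4) (o.1 5))) +
      (6 * Fintype.card ι * #Q + 17 * Fintype.card ι ^ 2) *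
        #((univ : Finset (Fin 6 → G)) ×ˢ agreeing Q) := by
  set Ω := (univ : Finset (Fin 6 → G)) ×ˢ agreeing Q with hΩ
  set P := Q.image Prod.fst
  set H1 := Ω.filter fun o => HalfBad P o.2 (fun i => A i + o.1 0) (fun i => B i + o.1 1)
    (fun i => S i + o.1 2) (fun i => T i + o.1 3) (o.1 4) (o.1 5) with hH1
  set H2 := Ω.filter fun o => HalfBad P o.2 (fun i => T i + o.1 3) (fun i => S i + o.1 2)
    (fun i => B i + o.1 1) (fun i => A i + o.1 0) (o.1 5) (o.1 4) with hH2
  set C := Ω.filter fun o => Connects o.2 (fun i => A i + o.1 0) (fun i => B i + o.1 1)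
    (fun i => S i + o.1 2) (fun i => T i + o.1 3) (o.1 4) (o.1 5) with hC
  have h3 : #(Ω \ (H1 ∪ H2)) ≤ Fintype.card G ^ (2 * Fintype.card ι) * #C := by
    have h4 : Ω \ (H1 ∪ H2) = Ω.filter fun o =>
        ¬ HalfBad P o.2 (fun i => A i + o.1 0) (fun i => B i + o.1 1)
          (fun i => S i + o.1 2) (fun i => T i + o.1 3) (o.1 4) (o.1 5) ∧
        ¬ HalfBad P o.2 (fun i => T i + o.1 3) (fun i => S i + o.1 2)
          (fun i => B i + o.1 1) (fun i => A i + o.1 0) (o.1 5) (o.1 4) := by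
      rw [hH1, hH2, ← filter_or, ← filter_not]
      simp only [not_or]
    rw [h4, hC, card_filter, card_filter, hΩ, sum_product, sum_product, mul_sum]
    refine sum_le_sum fun κ _ => ?_
    have h := card_not_halfBad_le (fun i => A i + κ 0) (fun i => B i + κ 1) (fun i => S i + κ 2)
      (fun i => T i + κ 3) (κ 4) (κ 5) Q
    rw [card_filter, card_filter] at h
    exact h
  have h5 : #Ω ≤ #(Ω \ (H1 ∪ H2)) + (#H1 + #H2) :=
    calc #Ω ≤ #(Ω \ (H1 ∪ H2)) + #(H1 ∪ H2) :=
          card_le_card_sdiff_add_card (s := Ω) (t := H1 ∪ H2)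
      _ ≤ _ := Nat.add_le_add_left (card_union_le _ _) _
  have h7 : 4 * Fintype.card G * #H1 ≤
      (12 * Fintype.card ι * #Q + 34 * Fintype.card ι ^ 2) * #Ω :=
    card_halfBad_le A B S T 1 Q hQ hA hAS
  have h8 : 4 * Fintype.card G * #H2 ≤
      (12 * Fintype.card ι * #Q + 34 * Fintype.card ι ^ 2) * #Ω :=
    card_halfBad_le T S B A
      -- Reading the cipher backwards exchanges the masks of `a` and `t`, those of `b` and `s`, and
      -- the two middle half-keys.
      ⟨![3, 2, 1, 0, 5, 4], ![3, 2, 1, 0, 5, 4], by decide, by decide⟩ Q hQ hT hTB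
  have h6 := Nat.mul_le_mul_left (Fintype.card G) (h5.trans (Nat.add_le_add_right h3 _))
  nlinarith [h6, h7, h8]

end Core

/-! ### Adaptive interaction and the H-coefficient method -/

section Interaction

variable {m n : ℕ}

/-- The pair of oracles agrees with the recorded query-answer pairs. -/
def Consistent (QE : Finset (Bits m × Bits m)) (Qf : Finset (Bits n × Bits n))
    (o : Perm (Bits m) × Perm (Bits n)) : Prop :=
  Agrees o.1 QE ∧ Agrees o.2 Qf

open Classical in
/-- The probability, for oracle weights `w`, of consistency with the recorded pairs and `P`. -/
noncomputable def mass (w : Perm (Bits m) × Perm (Bits n) → ℝ) (QE : Finset (Bits m × Bits m))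
    (Qf : Finset (Bits n × Bits n)) (P : Perm (Bits m) × Perm (Bits n) → Prop) : ℝ :=
  ∑ o, if Consistent QE Qf o ∧ P o then w o else 0

variable {w w' : Perm (Bits m) × Perm (Bits n) → ℝ} {QE : Finset (Bits m × Bits m)}
  {Qf : Finset (Bits n × Bits n)} {P P' : Perm (Bits m) × Perm (Bits n) → Prop}

theorem mass_nonneg (hw : ∀ o, 0 ≤ w o) : 0 ≤ mass w QE Qf P :=
  sum_nonneg fun o _ => by split_ifs <;> simp [hw]

theorem mass_mono (hw : ∀ o, 0 ≤ w o) (h : ∀ o, Consistent QE Qf o → P o → P' o) :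
    mass w QE Qf P ≤ mass w QE Qf P' := by
  refine sum_le_sum fun o _ => ?_
  by_cases h1 : Consistent QE Qf o ∧ P o
  · rw [if_pos h1, if_pos ⟨h1.1, h o h1.1 h1.2⟩]
  · rw [if_neg h1]
    split_ifs <;> simp [hw]

theorem mass_eq_zero (h : ∀ o, Consistent QE Qf o → ¬ P o) : mass w QE Qf P = 0 :=
  sum_eq_zero fun o _ => if_neg fun ho => h o ho.1 ho.2

/-- Splitting a mass according to the answer to a query. -/
theorem mass_eq_sum {β : Type*} [Fintype β] (g : Perm (Bits m) × Perm (Bits n) → β)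
    (QE' : β → Finset (Bits m × Bits m)) (Qf' : β → Finset (Bits n × Bits n))
    (R : β → Perm (Bits m) × Perm (Bits n) → Prop)
    (hcons : ∀ y o, Consistent (QE' y) (Qf' y) o ↔ Consistent QE Qf o ∧ g o = y)
    (hR : ∀ o, P o ↔ R (g o) o) :
    mass w QE Qf P = ∑ y, mass w (QE' y) (Qf' y) (R y) := by
  classical
  unfold mass
  rw [sum_comm]
  refine sum_congr rfl fun o _ => ?_
  rw [sum_eq_single (g o)]
  · simp only [hcons, hR, and_true]
  · intro y _ hy
    rw [if_neg]
    rintro ⟨h1, -⟩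
    exact hy ((hcons y o).1 h1).2.symm
  · simp

theorem consistent_insert_left {x y : Bits m} {o : Perm (Bits m) × Perm (Bits n)} :
    Consistent (insert (x, y) QE) Qf o ↔ Consistent QE Qf o ∧ o.1 x = y := by
  simp only [Consistent, agrees_insert]
  tauto

theorem consistent_insert_left_symm {x y : Bits m} {o : Perm (Bits m) × Perm (Bits n)} :
    Consistent (insert (x, y) QE) Qf o ↔ Consistent QE Qf o ∧ o.1.symm y = x := by
  rw [consistent_insert_left, Equiv.symm_apply_eq, eq_comm (a := y)]

theorem consistent_insert_right {x y : Bits n} {o : Perm (Bits m) × Perm (Bits n)} :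
    Consistent QE (insert (x, y) Qf) o ↔ Consistent QE Qf o ∧ o.2 x = y := by
  simp only [Consistent, agrees_insert]
  tauto

theorem consistent_insert_right_symm {x y : Bits n} {o : Perm (Bits m) × Perm (Bits n)} :
    Consistent QE (insert (x, y) Qf) o ↔ Consistent QE Qf o ∧ o.2.symm y = x := by
  rw [consistent_insert_right, Equiv.symm_apply_eq, eq_comm (a := y)]

/-- The step of the H-coefficient argument at a query: the answers `y` that keep the transcript
good are handled by `h`, the other ones have small mass in total. -/
theorem sum_mass_le_of_good {β : Type*} [Fintype β] (hw : ∀ o, 0 ≤ w o) (hw' : ∀ o, 0 ≤ w' o)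
    (QE' : β → Finset (Bits m × Bits m)) (Qf' : β → Finset (Bits n × Bits n))
    (R : β → Perm (Bits m) × Perm (Bits n) → Prop) (good : β → Prop) [DecidablePred good]
    {ε δ M : ℝ} (hε : 0 ≤ ε)
    (h : ∀ y, good y → mass w (QE' y) (Qf' y) (R y) ≤ mass w' (QE' y) (Qf' y) (R y) +
      ε * mass w (QE' y) (Qf' y) fun _ => True)
    (hM : ∑ y, mass w (QE' y) (Qf' y) (fun _ => True) = M)
    (hbad : ∑ y with ¬ good y, mass w (QE' y) (Qf' y) (fun _ => True) ≤ δ * M) :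
    ∑ y, mass w (QE' y) (Qf' y) (R y) ≤
      ∑ y, mass w' (QE' y) (Qf' y) (R y) + (ε + δ) * M := by
  have h1 : ∀ y, mass w (QE' y) (Qf' y) (R y) ≤ mass w' (QE' y) (Qf' y) (R y) +
      ε * mass w (QE' y) (Qf' y) (fun _ => True) +
      if ¬ good y then mass w (QE' y) (Qf' y) (fun _ => True) else 0 := by
    intro y
    by_cases hy : good y
    · simpa [hy] using h y hy
    · rw [if_pos hy]
      have h2 : mass w (QE' y) (Qf' y) (R y) ≤ mass w (QE' y) (Qf' y) fun _ => True :=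
        mass_mono hw fun _ _ _ => trivial
      have h3 : 0 ≤ mass w' (QE' y) (Qf' y) (R y) := mass_nonneg hw'
      have h4 : 0 ≤ mass w (QE' y) (Qf' y) fun _ => True := mass_nonneg hw
      have := mul_nonneg hε h4
      linarith
  refine (sum_le_sum fun y _ => h1 y).trans ?_
  rw [sum_add_distrib, sum_add_distrib, ← mul_sum, hM, ← sum_filter]
  linarith

open Classical in
/-- The H-coefficient method: if consistency with every good transcript is almost as likely for
`w'` as for `w`, and every cipher query is unlikely to make the transcript bad for `w`, then every
output is at most slightly less likely for `w'` than for `w`. -/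
theorem mass_run_le (hw : ∀ o, 0 ≤ w o) (hw' : ∀ o, 0 ≤ w' o)
    (good : Finset (Bits m × Bits m) → Prop) (p q : ℕ) {ε δ : ℝ} (hε : 0 ≤ ε) (hδ : 0 ≤ δ)
    (hleaf : ∀ QE Qf, good QE → #QE ≤ p → #Qf ≤ q →
      mass w QE Qf (fun _ => True) ≤ mass w' QE Qf (fun _ => True) +
        ε * mass w QE Qf fun _ => True)
    (henc : ∀ QE Qf x, good QE → #QE ≤ p →
      ∑ y with ¬ good (insert (x, y) QE), mass w (insert (x, y) QE) Qf (fun _ => True) ≤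
        δ * mass w QE Qf fun _ => True)
    (hdec : ∀ QE Qf y, good QE → #QE ≤ p →
      ∑ x with ¬ good (insert (x, y) QE), mass w (insert (x, y) QE) Qf (fun _ => True) ≤
        δ * mass w QE Qf fun _ => True)
    (b : Bool) (s : Strategy m n) : ∀ (QE : Finset (Bits m × Bits m))
      (Qf : Finset (Bits n × Bits n)) (c d : ℕ), good QE → #QE ≤ c → #Qf ≤ d →
      (∀ o, Consistent QE Qf o → c + s.cipherQueries o.1 o.2 ≤ p ∧
        d + s.permQueries o.1 o.2 ≤ q) →
      mass w QE Qf (fun o => s.run o.1 o.2 = b) ≤ mass w' QE Qf (fun o => s.run o.1 o.2 = b) +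
        (ε + δ * ((p : ℝ) - c)) * mass w QE Qf fun _ => True := by
  induction s with
  | output b' =>
    intro QE Qf c d hg hc hd hb
    -- The query budget is only known along consistent oracles; without any, `p - c` may be
    -- negative, but all masses vanish.
    by_cases hex : ∃ o : Perm (Bits m) × Perm (Bits n), Consistent QE Qf o
    swap
    · have h0 : ∀ P, mass w QE Qf P = 0 := fun P => mass_eq_zero fun o ho => (hex ⟨o, ho⟩).elim
      rw [h0, h0, mul_zero, add_zero]
      exact mass_nonneg hw'
    obtain ⟨o, ho⟩ := hex
    obtain ⟨h1, h2⟩ := hb o ho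
    have hcp : c ≤ p := by omega
    have h3 : 0 ≤ δ * ((p : ℝ) - c) := mul_nonneg hδ (sub_nonneg.2 (by exact_mod_cast hcp))
    have h4 : 0 ≤ mass w QE Qf fun _ => True := mass_nonneg hw
    have h5 := mul_nonneg h3 h4
    by_cases hbb : b' = b
    · simp only [Strategy.run, hbb]
      have := hleaf QE Qf hg (hc.trans hcp) (by omega)
      linarith
    · simp only [Strategy.run, hbb]
      rw [mass_eq_zero (w := w) (P := fun _ => False) fun _ _ => id]
      have h6 : 0 ≤ mass w' QE Qf fun _ => False := mass_nonneg hw'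
      have := mul_nonneg hε h4
      linarith
  | enc x next ih =>
    intro QE Qf c d hg hc hd hb
    by_cases hex : ∃ o : Perm (Bits m) × Perm (Bits n), Consistent QE Qf o
    swap
    · have h0 : ∀ P, mass w QE Qf P = 0 := fun P => mass_eq_zero fun o ho => (hex ⟨o, ho⟩).elim
      rw [h0, h0, mul_zero, add_zero]
      exact mass_nonneg hw'
    obtain ⟨o, ho⟩ := hex
    have hcp : c + 1 ≤ p := by
      have := (hb o ho).1
      simp only [Strategy.cipherQueries] at this
      omega
    have hsplit : ∀ (v : Perm (Bits m) × Perm (Bits n) → ℝ)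
        (P : Perm (Bits m) × Perm (Bits n) → Prop)
        (R : Bits m → Perm (Bits m) × Perm (Bits n) → Prop),
        (∀ o, P o ↔ R (o.1 x) o) → mass v QE Qf P =
          ∑ y, mass v (insert (x, y) QE) Qf (R y) := fun v P R hR =>
      mass_eq_sum (fun o => o.1 x) _ (fun _ => Qf) R (fun y o => consistent_insert_left) hR
    rw [hsplit w (fun o => (Strategy.enc x next).run o.1 o.2 = b)
        (fun y o => (next y).run o.1 o.2 = b) fun o => Iff.rfl,
      hsplit w' (fun o => (Strategy.enc x next).run o.1 o.2 = b)
        (fun y o => (next y).run o.1 o.2 = b) fun o => Iff.rfl]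
    have hstep := sum_mass_le_of_good hw hw' (fun y => insert (x, y) QE) (fun _ => Qf)
      (fun y o => (next y).run o.1 o.2 = b) (fun y => good (insert (x, y) QE))
      -- The current query spends one `δ` of the remaining `p - c`.
      (ε := ε + δ * ((p : ℝ) - (c + 1))) (δ := δ)
      (add_nonneg hε (mul_nonneg hδ (sub_nonneg.2 (by exact_mod_cast hcp))))
      (fun y hy => by
        have h := ih y (insert (x, y) QE) Qf (c + 1) d hy
          ((card_insert_le _ _).trans (Nat.add_le_add_right hc 1)) hd fun o ho => by
            obtain ⟨ho1, ho2⟩ := consistent_insert_left.1 ho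
            have := hb o ho1
            simp only [Strategy.cipherQueries, Strategy.permQueries, ho2] at this
            omega
        push_cast at h
        exact h)
      (hsplit w (fun _ => True) (fun _ _ => True) fun _ => Iff.rfl).symm
      (henc QE Qf x hg (by omega))
    refine hstep.trans (le_of_eq ?_)
    ring
  | dec y next ih =>
    intro QE Qf c d hg hc hd hb
    by_cases hex : ∃ o : Perm (Bits m) × Perm (Bits n), Consistent QE Qf o
    swap
    · have h0 : ∀ P, mass w QE Qf P = 0 := fun P => mass_eq_zero fun o ho => (hex ⟨o, ho⟩).elim
      rw [h0, h0, mul_zero, add_zero]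
      exact mass_nonneg hw'
    obtain ⟨o, ho⟩ := hex
    have hcp : c + 1 ≤ p := by
      have := (hb o ho).1
      simp only [Strategy.cipherQueries] at this
      omega
    have hsplit : ∀ (v : Perm (Bits m) × Perm (Bits n) → ℝ)
        (P : Perm (Bits m) × Perm (Bits n) → Prop)
        (R : Bits m → Perm (Bits m) × Perm (Bits n) → Prop),
        (∀ o, P o ↔ R (o.1.symm y) o) → mass v QE Qf P =
          ∑ x, mass v (insert (x, y) QE) Qf (R x) := fun v P R hR =>
      mass_eq_sum (fun o => o.1.symm y) _ (fun _ => Qf) R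
        (fun x o => consistent_insert_left_symm) hR
    rw [hsplit w (fun o => (Strategy.dec y next).run o.1 o.2 = b)
        (fun x o => (next x).run o.1 o.2 = b) fun o => Iff.rfl,
      hsplit w' (fun o => (Strategy.dec y next).run o.1 o.2 = b)
        (fun x o => (next x).run o.1 o.2 = b) fun o => Iff.rfl]
    have hstep := sum_mass_le_of_good hw hw' (fun x => insert (x, y) QE) (fun _ => Qf)
      (fun x o => (next x).run o.1 o.2 = b) (fun x => good (insert (x, y) QE))
      (ε := ε + δ * ((p : ℝ) - (c + 1))) (δ := δ)
      (add_nonneg hε (mul_nonneg hδ (sub_nonneg.2 (by exact_mod_cast hcp))))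
      (fun x hx => by
        have h := ih x (insert (x, y) QE) Qf (c + 1) d hx
          ((card_insert_le _ _).trans (Nat.add_le_add_right hc 1)) hd fun o ho => by
            obtain ⟨ho1, ho2⟩ := consistent_insert_left_symm.1 ho
            have := hb o ho1
            simp only [Strategy.cipherQueries, Strategy.permQueries, ho2] at this
            omega
        push_cast at h
        exact h)
      (hsplit w (fun _ => True) (fun _ _ => True) fun _ => Iff.rfl).symm
      (hdec QE Qf y hg (by omega))
    refine hstep.trans (le_of_eq ?_)
    ring
  | fwd x next ih =>
    intro QE Qf c d hg hc hd hb
    have hsplit : ∀ (v : Perm (Bits m) × Perm (Bits n) → ℝ)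
        (P : Perm (Bits m) × Perm (Bits n) → Prop)
        (R : Bits n → Perm (Bits m) × Perm (Bits n) → Prop),
        (∀ o, P o ↔ R (o.2 x) o) → mass v QE Qf P =
          ∑ y, mass v QE (insert (x, y) Qf) (R y) := fun v P R hR =>
      mass_eq_sum (fun o => o.2 x) (fun _ => QE) _ R (fun y o => consistent_insert_right) hR
    rw [hsplit w (fun o => (Strategy.fwd x next).run o.1 o.2 = b)
        (fun y o => (next y).run o.1 o.2 = b) fun o => Iff.rfl,
      hsplit w' (fun o => (Strategy.fwd x next).run o.1 o.2 = b)
        (fun y o => (next y).run o.1 o.2 = b) fun o => Iff.rfl,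
      -- A query to `f` cannot spoil goodness, so the bounds for its answers add up without loss.
      hsplit w (fun _ => True) (fun _ _ => True) fun _ => Iff.rfl, mul_sum, ← sum_add_distrib]
    refine sum_le_sum fun y _ => ih y QE (insert (x, y) Qf) c (d + 1) hg hc
      ((card_insert_le _ _).trans (Nat.add_le_add_right hd 1)) fun o ho => ?_
    obtain ⟨ho1, ho2⟩ := consistent_insert_right.1 ho
    have := hb o ho1
    simp only [Strategy.cipherQueries, Strategy.permQueries, ho2] at this
    omega
  | bwd y next ih =>
    intro QE Qf c d hg hc hd hb
    have hsplit : ∀ (v : Perm (Bits m) × Perm (Bits n) → ℝ)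
        (P : Perm (Bits m) × Perm (Bits n) → Prop)
        (R : Bits n → Perm (Bits m) × Perm (Bits n) → Prop),
        (∀ o, P o ↔ R (o.2.symm y) o) → mass v QE Qf P =
          ∑ x, mass v QE (insert (x, y) Qf) (R x) := fun v P R hR =>
      mass_eq_sum (fun o => o.2.symm y) (fun _ => QE) _ R
        (fun x o => consistent_insert_right_symm) hR
    rw [hsplit w (fun o => (Strategy.bwd y next).run o.1 o.2 = b)
        (fun x o => (next x).run o.1 o.2 = b) fun o => Iff.rfl,
      hsplit w' (fun o => (Strategy.bwd y next).run o.1 o.2 = b)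
        (fun x o => (next x).run o.1 o.2 = b) fun o => Iff.rfl,
      hsplit w (fun _ => True) (fun _ _ => True) fun _ => Iff.rfl, mul_sum, ← sum_add_distrib]
    refine sum_le_sum fun x _ => ih x QE (insert (x, y) Qf) c (d + 1) hg hc
      ((card_insert_le _ _).trans (Nat.add_le_add_right hd 1)) fun o ho => ?_
    obtain ⟨ho1, ho2⟩ := consistent_insert_right_symm.1 ho
    have := hb o ho1
    simp only [Strategy.cipherQueries, Strategy.permQueries, ho2] at this
    omega

end Interaction

/-! ### Transcript masses in the two worlds, and advantages -/

section Worlds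

variable {m n : ℕ}

theorem toReal_realWorld_apply {κ : Type} [Fintype κ] [Nonempty κ]
    (C : κ → Perm (Bits n) → Perm (Bits m)) (o : Perm (Bits m) × Perm (Bits n)) :
    (realWorld C o).toReal = ∑ z : κ × Perm (Bits n),
      if o = (C z.1 z.2, z.2) then
        ((Fintype.card κ : ℝ) * (Fintype.card (Perm (Bits n)) : ℝ))⁻¹ else 0 := by
  have h : realWorld C o = ∑ z : κ × Perm (Bits n), if o = (C z.1 z.2, z.2) then
      (Fintype.card κ : ENNReal)⁻¹ * (Fintype.card (Perm (Bits n)) : ENNReal)⁻¹ else 0 := by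
    rw [realWorld, PMF.bind_apply, tsum_fintype, Fintype.sum_prod_type]
    refine sum_congr rfl fun K _ => ?_
    rw [PMF.map_apply, tsum_fintype, mul_sum]
    refine sum_congr rfl fun f _ => ?_
    simp only [PMF.uniformOfFintype_apply]
    split_ifs <;> simp_all
  rw [h, ENNReal.toReal_sum]
  · refine sum_congr rfl fun z _ => ?_
    split_ifs
    · rw [ENNReal.toReal_mul, ENNReal.toReal_inv, ENNReal.toReal_inv, ENNReal.toReal_natCast,
        ENNReal.toReal_natCast, mul_inv]
    · simp
  · intro z _
    split_ifs
    · exact ENNReal.mul_ne_top (by simp) (by simp)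
    · simp

open Classical in
theorem mass_realWorld {κ : Type} [Fintype κ] [Nonempty κ]
    (C : κ → Perm (Bits n) → Perm (Bits m)) (QE : Finset (Bits m × Bits m))
    (Qf : Finset (Bits n × Bits n)) :
    mass (fun o => (realWorld C o).toReal) QE Qf (fun _ => True) =
      (#(((univ : Finset κ) ×ˢ agreeing Qf).filter fun z => Agrees (C z.1 z.2) QE) : ℝ) /
        ((Fintype.card κ : ℝ) * (Fintype.card (Perm (Bits n)) : ℝ)) := by
  simp only [mass, toReal_realWorld_apply, and_true]
  have h1 : ∀ o : Perm (Bits m) × Perm (Bits n),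
      (if Consistent QE Qf o then ∑ z : κ × Perm (Bits n), if o = (C z.1 z.2, z.2) then
        ((Fintype.card κ : ℝ) * (Fintype.card (Perm (Bits n)) : ℝ))⁻¹ else 0 else 0) =
      ∑ z : κ × Perm (Bits n), if o = (C z.1 z.2, z.2) then
        (if Consistent QE Qf o then
          ((Fintype.card κ : ℝ) * (Fintype.card (Perm (Bits n)) : ℝ))⁻¹ else 0) else 0 := by
    intro o
    split_ifs <;> simp
  rw [sum_congr rfl fun o _ => h1 o, sum_comm]
  simp only [sum_ite_eq', mem_univ, if_true]
  rw [← sum_filter, sum_const, nsmul_eq_mul, div_eq_mul_inv]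
  congr 3
  ext z
  rw [mem_filter, mem_filter]
  simp only [mem_univ, mem_product, mem_agreeing, Consistent, true_and]
  tauto

theorem mass_idealWorld (QE : Finset (Bits m × Bits m)) (Qf : Finset (Bits n × Bits n)) :
    mass (fun o => (idealWorld m n o).toReal) QE Qf (fun _ => True) =
      (#(agreeing QE) : ℝ) * (#(agreeing Qf) : ℝ) /
        ((Fintype.card (Perm (Bits m)) : ℝ) * (Fintype.card (Perm (Bits n)) : ℝ)) := by
  classical
  have h : idealWorld m n = realWorld (fun (E : Perm (Bits m)) (_ : Perm (Bits n)) => E) := rfl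
  rw [h, mass_realWorld, ← Nat.cast_mul #(agreeing QE), ← card_product]
  congr 3
  ext z
  simp [and_comm]

open Classical in
theorem toReal_map_run (O : PMF (Perm (Bits m) × Perm (Bits n))) (s : Strategy m n) (b : Bool) :
    ((O.map fun o => s.run o.1 o.2) b).toReal =
      mass (fun o => (O o).toReal) ∅ ∅ fun o => s.run o.1 o.2 = b := by
  rw [PMF.map_apply, tsum_fintype, ENNReal.toReal_sum]
  · refine sum_congr rfl fun o _ => ?_
    simp only [Consistent, Agrees, notMem_empty, false_imp_iff, implies_true, true_and,
      eq_comm (a := b)]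
    split_ifs <;> simp
  · intro o _
    split_ifs
    · exact PMF.apply_ne_top _ _
    · simp

theorem apply_true_add_apply_false (O : PMF Bool) :
    (O true).toReal + (O false).toReal = 1 := by
  have h := O.tsum_coe
  rw [tsum_fintype, Fintype.sum_bool] at h
  rw [← ENNReal.toReal_add (PMF.apply_ne_top _ _) (PMF.apply_ne_top _ _), h, ENNReal.toReal_one]

theorem Adversary.prOutputOne_le {qc q : ℕ} (A : Adversary m n qc q)
    (O O' : PMF (Perm (Bits m) × Perm (Bits n))) {η : ℝ} (hη : 0 ≤ η)
    (h : ∀ s ∈ A.coins.support, ((O.map fun o => s.run o.1 o.2) true).toReal ≤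
      ((O'.map fun o => s.run o.1 o.2) true).toReal + η) :
    A.prOutputOne O ≤ A.prOutputOne O' + η := by
  have h1 : (A.coins.bind fun s => O.map fun o => s.run o.1 o.2) true ≤
      (A.coins.bind fun s => O'.map fun o => s.run o.1 o.2) true + ENNReal.ofReal η := by
    rw [PMF.bind_apply, PMF.bind_apply]
    calc _ ≤ ∑' s, (A.coins s * (O'.map fun o => s.run o.1 o.2) true +
          A.coins s * ENNReal.ofReal η) := by
          refine ENNReal.tsum_le_tsum fun s => ?_
          by_cases hs : s ∈ A.coins.support
          · rw [← mul_add]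
            gcongr
            have h2 := ENNReal.ofReal_le_ofReal (h s hs)
            rwa [ENNReal.ofReal_add ENNReal.toReal_nonneg hη,
              ENNReal.ofReal_toReal (PMF.apply_ne_top _ _),
              ENNReal.ofReal_toReal (PMF.apply_ne_top _ _)] at h2
          · rw [(PMF.apply_eq_zero_iff _ _).2 hs]
            simp
      _ = _ := by rw [ENNReal.tsum_add, ENNReal.tsum_mul_right, PMF.tsum_coe, one_mul]
  unfold Adversary.prOutputOne
  rw [← ENNReal.toReal_ofReal hη, ← ENNReal.toReal_add (PMF.apply_ne_top _ _)
    ENNReal.ofReal_ne_top]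
  exact ENNReal.toReal_mono (ENNReal.add_ne_top.2 ⟨PMF.apply_ne_top _ _, ENNReal.ofReal_ne_top⟩) h1

theorem mass_empty_true (O : PMF (Perm (Bits m) × Perm (Bits n))) :
    mass (fun o => (O o).toReal) ∅ ∅ (fun _ => True) = 1 := by
  have h := toReal_map_run O (.output true) true
  simp only [Strategy.run] at h
  have h1 : (O.map fun _ => true) = PMF.pure true := PMF.map_const O true
  simpa [h1] using h.symm

/-- A one-sided bound suffices: the probabilities of the two outputs sum to 1, so the bound for
`false` is the reverse bound for `true`. -/
theorem Adversary.advantage_le {qc q : ℕ} (A : Adversary m n qc q)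
    (O O' : PMF (Perm (Bits m) × Perm (Bits n))) {η : ℝ} (hη : 0 ≤ η)
    (h : ∀ s ∈ A.coins.support, ∀ b, ((O'.map fun o => s.run o.1 o.2) b).toReal ≤
      ((O.map fun o => s.run o.1 o.2) b).toReal + η) :
    A.advantage O O' ≤ η := by
  refine abs_sub_le_iff.2 ⟨?_, ?_⟩
  · have := A.prOutputOne_le O O' hη fun s hs => by
      have h1 := h s hs false
      have h2 := apply_true_add_apply_false (O.map fun o => s.run o.1 o.2)
      have h3 := apply_true_add_apply_false (O'.map fun o => s.run o.1 o.2)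
      linarith
    linarith
  · have := A.prOutputOne_le O' O hη fun s hs => h s hs true
    linarith

end Worlds

/-! ### The cipher in terms of half-blocks -/

section Cipher

variable {n : ℕ}

theorem LR2_apply (f : Bits n → Bits n) (w : Bits (n + n)) :
    LR2 f w = concat (left w + f (right w)) (right w + f (left w + f (right w))) := by
  simp [LR2, LR]

theorem left_add (v w : Bits (n + n)) : left (v + w) = left v + left w := rfl

theorem right_add (v w : Bits (n + n)) : right (v + w) = right v + right w := rfl

theorem bits_ext {v w : Bits (n + n)} (h1 : left v = left w) (h2 : right v = right w) : v = w := by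
  rw [← concat_left_right v, h1, h2, concat_left_right]

theorem bits_add_self (u : Bits n) : u + u = 0 := by
  funext i
  exact CharTwo.add_self_eq_zero _

theorem BPEM_two_apply (K : Fin 3 → Bits (n + n)) (f : Perm (Bits n)) (w : Bits (n + n)) :
    BPEM 2 ![K 0, K 1, K 2] ![f, f] w = LR2 f (LR2 f (w + K 0) + K 1) + K 2 := rfl

/-- The keys of the two-round cipher assembled from six half-keys. -/
def assembleKeys (κ : Fin 6 → Bits n) : Fin 3 → Bits (n + n) :=
  ![concat (κ 0) (κ 1), concat (κ 4) (κ 5), concat (κ 2) (κ 3)]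

theorem assembleKeys_injective : Function.Injective (assembleKeys (n := n)) := by
  intro κ κ' h
  have h0 := congrFun h 0
  have h1 := congrFun h 1
  have h2 := congrFun h 2
  simp only [assembleKeys, Matrix.cons_val] at h0 h1 h2
  funext i
  fin_cases i
  · simpa using congrArg left h0
  · simpa using congrArg right h0
  · simpa using congrArg left h2
  · simpa using congrArg right h2
  · simpa using congrArg left h1
  · simpa using congrArg right h1

/-- Meeting in the middle: `h1` says that the right half entering the second round is `t + f s`, and
`h2` then makes its left output half equal to `s`. -/
theorem agrees_BPEM_of_connects {QE : Finset (Bits (n + n) × Bits (n + n))} {κ : Fin 6 → Bits n}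
    {f : Perm (Bits n)}
    (h : Connects f (fun e : QE => left e.1.1 + κ 0) (fun e => right e.1.1 + κ 1)
      (fun e => left e.1.2 + κ 2) (fun e => right e.1.2 + κ 3) (κ 4) (κ 5)) :
    Agrees (BPEM 2 ![assembleKeys κ 0, assembleKeys κ 1, assembleKeys κ 2] ![f, f]) QE := by
  intro e he
  obtain ⟨h1, h2⟩ := h ⟨e, he⟩
  dsimp only at h1 h2
  rw [BPEM_two_apply]
  have k0 : assembleKeys κ 0 = concat (κ 0) (κ 1) := rfl
  have k1 : assembleKeys κ 1 = concat (κ 4) (κ 5) := rfl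
  have k2 : assembleKeys κ 2 = concat (κ 2) (κ 3) := rfl
  have e1 : right e.1 + κ 1 + f (left e.1 + κ 0 + f (right e.1 + κ 1)) + κ 5 =
      right e.2 + κ 3 + f (left e.2 + κ 2) := by
    rw [h1]
    calc _ = right e.2 + κ 3 + f (left e.2 + κ 2) + ((right e.1 + κ 1) + (right e.1 + κ 1)) +
          (κ 5 + κ 5) := by abel
      _ = _ := by rw [bits_add_self, bits_add_self, add_zero, add_zero]
  have e2 : left e.1 + κ 0 + f (right e.1 + κ 1) + κ 4 +
      f (right e.2 + κ 3 + f (left e.2 + κ 2)) = left e.2 + κ 2 := by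
    rw [h2]
    set u := left e.1 + κ 0 + f (right e.1 + κ 1)
    calc _ = left e.2 + κ 2 + (u + u) + (κ 4 + κ 4) := by abel
      _ = _ := by rw [bits_add_self, bits_add_self, add_zero, add_zero]
  refine bits_ext ?_ ?_
  · simp only [left_add, right_add, LR2_apply, left_concat, right_concat, k0, k1, k2, e1, e2,
      xor_xor]
  · simp only [left_add, right_add, LR2_apply, left_concat, right_concat, k0, k1, k2, e1, e2,
      xor_xor]

end Cipher

/-! ### Bad transcripts in the ideal world -/

section Transcripts

variable {n : ℕ}

/-- Two input-output pairs that would force a collision between inner evaluations of `f`. -/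
def Clash (e e' : Bits (n + n) × Bits (n + n)) : Prop :=
  (left e.2 = left e'.2 ∧ right e.2 + right e.1 = right e'.2 + right e'.1) ∨
  (right e.1 = right e'.1 ∧ left e.1 + left e.2 = left e'.1 + left e'.2)

theorem Clash.symm {e e' : Bits (n + n) × Bits (n + n)} (h : Clash e e') : Clash e' e :=
  h.imp (fun h => ⟨h.1.symm, h.2.symm⟩) fun h => ⟨h.1.symm, h.2.symm⟩

/-- A transcript without clashing pairs. -/
def GoodTranscript (QE : Finset (Bits (n + n) × Bits (n + n))) : Prop :=
  ∀ e ∈ QE, ∀ e' ∈ QE, e ≠ e' → ¬ Clash e e'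

theorem exists_clash_of_not_good_insert {QE : Finset (Bits (n + n) × Bits (n + n))}
    {e : Bits (n + n) × Bits (n + n)} (hg : GoodTranscript QE)
    (h : ¬ GoodTranscript (insert e QE)) : ∃ e' ∈ QE, Clash e e' := by
  contrapose! h
  intro e₁ h₁ e₂ h₂ hne hc
  rcases mem_insert.1 h₁ with h₁' | h₁' <;> rcases mem_insert.1 h₂ with h₂' | h₂'
  · exact hne (h₁'.trans h₂'.symm)
  · exact h _ h₂' (h₁' ▸ hc)
  · exact h _ h₁' (h₂' ▸ hc).symm
  · exact hg _ h₁' _ h₂' hne hc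

theorem card_bits (m : ℕ) : Fintype.card (Bits m) = 2 ^ m := by simp [Bits, ZMod.card]

open Classical in
-- The first kind of clash determines `y` completely; the second determines only its left half.
theorem card_clash_snd_le (x : Bits (n + n)) (e : Bits (n + n) × Bits (n + n)) :
    #(univ.filter fun y => Clash (x, y) e) ≤ 2 ^ n + 1 := by
  calc _ ≤ #(insert (concat (left e.2) (right e.2 + right e.1 - right x))
        (univ.image fun v : Bits n => concat (left e.1 + left e.2 - left x) v)) := by
        refine card_le_card fun y hy => ?_
        rcases (mem_filter.1 hy).2 with ⟨h1, h2⟩ | ⟨-, h2⟩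
        · refine mem_insert.2 (Or.inl ?_)
          dsimp only at h1 h2
          rw [← h1, ← h2, add_sub_cancel_right, concat_left_right]
        · refine mem_insert_of_mem (mem_image.2 ⟨right y, mem_univ _, ?_⟩)
          dsimp only at h2
          rw [← h2, add_sub_cancel_left, concat_left_right]
    _ ≤ _ := (card_insert_le _ _).trans (Nat.add_le_add_right
        (card_image_le.trans (by rw [card_univ, card_bits])) 1)

open Classical in
theorem card_clash_fst_le (y : Bits (n + n)) (e : Bits (n + n) × Bits (n + n)) :
    #(univ.filter fun x => Clash (x, y) e) ≤ 2 ^ n + 1 := by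
  calc _ ≤ #(insert (concat (left e.1 + left e.2 - left y) (right e.1))
        (univ.image fun v : Bits n => concat v (right e.2 + right e.1 - right y))) := by
        refine card_le_card fun x hx => ?_
        rcases (mem_filter.1 hx).2 with ⟨-, h2⟩ | ⟨h1, h2⟩
        · refine mem_insert_of_mem (mem_image.2 ⟨left x, mem_univ _, ?_⟩)
          dsimp only at h2
          rw [← h2, add_sub_cancel_left, concat_left_right]
        · refine mem_insert.2 (Or.inl ?_)
          dsimp only at h1 h2
          rw [← h1, ← h2, add_sub_cancel_right, concat_left_right]
    _ ≤ _ := (card_insert_le _ _).trans (Nat.add_le_add_right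
        (card_image_le.trans (by rw [card_univ, card_bits])) 1)

theorem card_agreeing_image_swap {α : Type*} [Fintype α] [DecidableEq α] (Q : Finset (α × α)) :
    #(agreeing (Q.image Prod.swap)) = #(agreeing Q) := by
  refine card_nbij' (fun f => f⁻¹) (fun f => f⁻¹) ?_ ?_ (fun f _ => inv_inv f)
    (fun f _ => inv_inv f)
  · intro f hf
    simp only [mem_coe, mem_agreeing, Agrees, mem_image, forall_exists_index, and_imp,
      forall_apply_eq_imp_iff₂, Prod.fst_swap, Prod.snd_swap] at hf ⊢
    exact fun e he => by
      rw [← hf e he]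
      exact f.symm_apply_apply _
  · intro f hf
    simp only [mem_coe, mem_agreeing, Agrees, mem_image, forall_exists_index, and_imp,
      forall_apply_eq_imp_iff₂, Prod.fst_swap, Prod.snd_swap] at hf ⊢
    exact fun e he => by
      rw [← hf e he]
      exact f.symm_apply_apply _

open Classical in
/-- A fresh query makes a transcript bad for few of its answers. -/
theorem mul_sum_card_agreeing_le {QE : Finset (Bits (n + n) × Bits (n + n))}
    (ins : Bits (n + n) → Bits (n + n) × Bits (n + n)) {p : ℕ}
    (hp : #QE ≤ p) (hg : GoodTranscript QE)
    (hclash : ∀ e, #(univ.filter fun y => Clash (ins y) e) ≤ 2 ^ n + 1)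
    (hU : ∀ y, (2 ^ (n + n) - p) * #(agreeing (insert (ins y) QE)) ≤ #(agreeing QE)) :
    (2 ^ (n + n) - p) * ∑ y with ¬ GoodTranscript (insert (ins y) QE),
      #(agreeing (insert (ins y) QE)) ≤ p * (2 ^ n + 1) * #(agreeing QE) := by
  rw [mul_sum]
  refine (sum_le_sum fun y _ => hU y).trans ?_
  rw [sum_const, smul_eq_mul]
  refine Nat.mul_le_mul_right _ ?_
  calc _ ≤ #(QE.biUnion fun e => univ.filter fun y => Clash (ins y) e) := by
        refine card_le_card fun y hy => ?_
        obtain ⟨e, he, hc⟩ := exists_clash_of_not_good_insert hg (mem_filter.1 hy).2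
        exact mem_biUnion.2 ⟨e, he, mem_filter.2 ⟨mem_univ _, hc⟩⟩
    _ ≤ #QE * (2 ^ n + 1) := card_biUnion_le_card_mul _ _ _ fun e _ => hclash e
    _ ≤ _ := Nat.mul_le_mul_right _ hp

theorem agreeing_insert_eq_empty {α : Type*} [Fintype α] [DecidableEq α] {Q : Finset (α × α)}
    {e e' : α × α} (he : e ∈ Q) (h : (e.1 = e'.1 ∧ e.2 ≠ e'.2) ∨ (e.2 = e'.2 ∧ e.1 ≠ e'.1)) :
    agreeing (insert e' Q) = ∅ := by
  refine eq_empty_of_forall_notMem fun f hf => ?_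
  rw [mem_agreeing] at hf
  have h1 := hf e (mem_insert_of_mem he)
  have h2 := hf e' (mem_insert_self _ _)
  rcases h with ⟨h3, h4⟩ | ⟨h3, h4⟩
  · rw [h3] at h1
    exact h4 (h1.symm.trans h2)
  · rw [h3, ← h2] at h1
    exact h4 (f.injective h1)

open Classical in
theorem mul_sum_card_agreeing_enc_le {QE : Finset (Bits (n + n) × Bits (n + n))} {p : ℕ}
    (hp : #QE ≤ p) (hg : GoodTranscript QE) (x : Bits (n + n)) :
    (2 ^ (n + n) - p) * ∑ y with ¬ GoodTranscript (insert (x, y) QE),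
      #(agreeing (insert (x, y) QE)) ≤ p * (2 ^ n + 1) * #(agreeing QE) := by
  by_cases hx : ∀ e ∈ QE, e.1 ≠ x
  · refine mul_sum_card_agreeing_le (fun y => (x, y)) hp hg (card_clash_snd_le x) fun y => ?_
    refine le_trans (Nat.mul_le_mul_right _ ?_) (sub_mul_card_agreeing_insert_le y hx)
    rw [card_bits]
    omega
  -- For a repeated query only the recorded answer is possible, and it leaves the transcript
  -- unchanged, hence good.
  · push Not at hx
    obtain ⟨e, he, rfl⟩ := hx
    rw [sum_eq_zero, mul_zero]
    · exact Nat.zero_le _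
    · intro y hy
      rw [card_eq_zero]
      refine agreeing_insert_eq_empty he (Or.inl ⟨rfl, ?_⟩)
      rintro rfl
      refine (mem_filter.1 hy).2 ?_
      rwa [insert_eq_of_mem he]

open Classical in
theorem mul_sum_card_agreeing_dec_le {QE : Finset (Bits (n + n) × Bits (n + n))} {p : ℕ}
    (hp : #QE ≤ p) (hg : GoodTranscript QE) (y : Bits (n + n)) :
    (2 ^ (n + n) - p) * ∑ x with ¬ GoodTranscript (insert (x, y) QE),
      #(agreeing (insert (x, y) QE)) ≤ p * (2 ^ n + 1) * #(agreeing QE) := by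
  by_cases hy : ∀ e ∈ QE, e.2 ≠ y
  · refine mul_sum_card_agreeing_le (fun x => (x, y)) hp hg (card_clash_fst_le y) fun x => ?_
    rw [← card_agreeing_image_swap, ← card_agreeing_image_swap QE, image_insert, Prod.swap_prod_mk]
    refine le_trans (Nat.mul_le_mul_right _ ?_) (sub_mul_card_agreeing_insert_le x ?_)
    · rw [card_bits]
      have : #(QE.image Prod.swap) ≤ #QE := card_image_le
      omega
    · intro e he
      obtain ⟨e, he', rfl⟩ := mem_image.1 he
      exact hy e he'
  · push Not at hy
    obtain ⟨e, he, rfl⟩ := hy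
    rw [sum_eq_zero, mul_zero]
    · exact Nat.zero_le _
    · intro x hx
      rw [card_eq_zero]
      refine agreeing_insert_eq_empty he (Or.inr ⟨rfl, ?_⟩)
      rintro rfl
      refine (mem_filter.1 hx).2 ?_
      rwa [insert_eq_of_mem he]

open Classical in
/-- The ideal-world probability that a query makes the transcript bad. -/
theorem sum_mass_idealWorld_le {QE : Finset (Bits (n + n) × Bits (n + n))}
    {Qf : Finset (Bits n × Bits n)} {p : ℕ} (hpn : 21 * p ^ 2 < 2 ^ n)
    (ins : Bits (n + n) → Bits (n + n) × Bits (n + n))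
    (h : (2 ^ (n + n) - p) * ∑ y with ¬ GoodTranscript (insert (ins y) QE),
      #(agreeing (insert (ins y) QE)) ≤ p * (2 ^ n + 1) * #(agreeing QE)) :
    ∑ y with ¬ GoodTranscript (insert (ins y) QE),
      mass (fun o => (idealWorld (n + n) n o).toReal) (insert (ins y) QE) Qf (fun _ => True) ≤
      2 * p / 2 ^ n * mass (fun o => (idealWorld (n + n) n o).toReal) QE Qf fun _ => True := by
  simp only [mass_idealWorld]
  rw [← sum_div, ← sum_mul, ← Nat.cast_sum, ← mul_div_assoc, ← mul_assoc]
  refine div_le_div_of_nonneg_right (mul_le_mul_of_nonneg_right ?_ (Nat.cast_nonneg _))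
    (by positivity)
  set s := ∑ y with ¬ GoodTranscript (insert (ins y) QE), #(agreeing (insert (ins y) QE))
  set a := #(agreeing QE)
  set N := 2 ^ n with hN
  have hN2 : 2 ^ (n + n) = N * N := pow_add 2 n n
  -- This gives `p (N + 1) / (N² - p) ≤ 2p / N`.
  have h1 : N * (N + 1) ≤ 2 * (N * N - p) := by
    have h2 : N + 2 * p ≤ N * N := by
      rcases Nat.eq_zero_or_pos p with rfl | hp
      · nlinarith
      · nlinarith
    have h3 : p ≤ N * N := by omega
    zify [h3] at h2 ⊢
    nlinarith
  rw [hN2] at h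
  have hpos : 0 < N * N - p := by
    have : 0 < N * (N + 1) := by positivity
    omega
  have h4 : N * s ≤ 2 * p * a := by
    refine Nat.le_of_mul_le_mul_left ?_ hpos
    calc (N * N - p) * (N * s) = N * ((N * N - p) * s) := by ring
      _ ≤ N * (p * (N + 1) * a) := Nat.mul_le_mul_left _ h
      _ = N * (N + 1) * (p * a) := by ring
      _ ≤ 2 * (N * N - p) * (p * a) := Nat.mul_le_mul_right _ h1
      _ = _ := by ring
  have h5 : ((2 : ℝ) ^ n) = (N : ℝ) := by rw [hN]; push_cast; rfl
  have h6 : (N : ℝ) * s ≤ 2 * p * a := by exact_mod_cast h4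
  have h7 : (0 : ℝ) < N := by rw [← h5]; positivity
  rw [h5, div_mul_eq_mul_div, le_div_iff₀ h7]
  linarith

end Transcripts

/-! ### Comparing the two worlds and collecting the losses -/

section Main

/-- Here `A` counts keys, `X` and `Y` count permutations of half-blocks and blocks, `a` and `c`
those consistent with the transcript, and `r` the consistent real outcomes. The loss `η` comes from
coincidences; `θ` comes from Bernoulli's inequality for `(1 - p'/N²) ^ p'`. The ratio of real to
ideal is at least `(1 - η)(1 - θ) ≥ 1 - η - θ`. -/
theorem ideal_le_real_of_counts {N X Y a c r A B p q p' q' : ℝ} (k : ℕ) (hk : (k : ℝ) = p')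
    (hN : 1 ≤ N) (hX : 0 < X) (hY : 0 < Y) (hA : 0 < A) (ha : 0 ≤ a) (hc : 0 ≤ c)
    (hq0 : 0 ≤ q') (hpN : p' ≤ N * N) (hp : p' ≤ p) (hq : q' ≤ q)
    (hreal : N * (A * c) ≤ N * (N ^ (2 * k) * r) + (6 * p' * q' + 17 * p' ^ 2) * (A * c))
    (hideal : (N * N - p') ^ k * a ≤ Y) (hB : B = 6 * p * q + 18 * p ^ 2) (hr : 0 ≤ r) :
    a * c / (Y * X) ≤ r / (A * X) + B / N * (a * c / (Y * X)) := by
  have hp0 : 0 ≤ p' := hk ▸ Nat.cast_nonneg k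
  have hNpos : 0 < N := by linarith
  set η := (6 * p' * q' + 17 * p' ^ 2) / N with hη
  set θ := p' ^ 2 / (N * N) with hθ
  set i := a * c / (Y * X) with hi
  have hi0 : 0 ≤ i := by positivity
  have hM : 0 < N ^ (2 * k) := by positivity
  have h1 : (1 - η) * c / X ≤ N ^ (2 * k) * (r / (A * X)) := by
    rw [← mul_div_assoc, div_le_div_iff₀ hX (by positivity)]
    have h2 : (1 - η) * (A * c) ≤ N ^ (2 * k) * r := by
      refine le_of_mul_le_mul_left ?_ hNpos
      have h3 : N * η = 6 * p' * q' + 17 * p' ^ 2 := mul_div_cancel₀ _ hNpos.ne'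
      calc N * ((1 - η) * (A * c)) = N * (A * c) - N * η * (A * c) := by ring
        _ ≤ _ := by rw [h3]; linarith
    nlinarith
  have h4 : N ^ (2 * k) * (1 - θ) ≤ (N * N - p') ^ k := by
    have hbern := one_add_mul_le_pow (a := -(p' / (N * N))) (by
      have : p' / (N * N) ≤ 1 := (div_le_one (by positivity)).2 hpN
      linarith) k
    calc N ^ (2 * k) * (1 - θ) = (N * N) ^ k * (1 + k * -(p' / (N * N))) := by
          rw [hk, hθ, pow_mul, ← sq]
          ring
      _ ≤ (N * N) ^ k * (1 + -(p' / (N * N))) ^ k := by gcongr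
      _ = _ := by
          rw [← mul_pow]
          congr 1
          field_simp
          ring
  have h5 : N ^ (2 * k) * ((1 - θ) * i) ≤ c / X := by
    have h6 : N ^ (2 * k) * (1 - θ) * a ≤ Y := (mul_le_mul_of_nonneg_right h4 ha).trans hideal
    rw [hi, le_div_iff₀ hX]
    calc N ^ (2 * k) * ((1 - θ) * (a * c / (Y * X))) * X
        = (N ^ (2 * k) * (1 - θ) * a) * c / Y := by field_simp
      _ ≤ Y * c / Y := by gcongr
      _ = c := by field_simp
  have hθ0 : 0 ≤ θ := by positivity
  have hη0 : 0 ≤ η := by positivity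
  have hsum : η + θ ≤ B / N := by
    have h7 : θ ≤ p' ^ 2 / N := by
      refine div_le_div_of_nonneg_left (by positivity) hNpos ?_
      nlinarith
    have h8 : 6 * p' * q' + 18 * p' ^ 2 ≤ B := by
      rw [hB]
      have : p' * q' ≤ p * q := mul_le_mul hp hq hq0 (hp0.trans hp)
      have : p' ^ 2 ≤ p ^ 2 := pow_le_pow_left₀ hp0 hp 2
      linarith
    calc η + θ ≤ η + p' ^ 2 / N := by linarith
      _ = (6 * p' * q' + 18 * p' ^ 2) / N := by rw [hη]; ring
      _ ≤ _ := by gcongr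
  have hr0 : 0 ≤ r / (A * X) := by positivity
  have hkey : (1 - η - θ) * i ≤ r / (A * X) := by
    -- If `η > 1`, the left side is nonpositive and nothing is left to prove.
    by_cases hη1 : η ≤ 1
    · refine le_of_mul_le_mul_left ?_ hM
      have h9 := mul_le_mul_of_nonneg_left h5 (sub_nonneg.2 hη1)
      calc N ^ (2 * k) * ((1 - η - θ) * i)
          ≤ (1 - η) * (N ^ (2 * k) * ((1 - θ) * i)) := by
            have : 0 ≤ N ^ (2 * k) * (η * θ * i) := by positivity
            nlinarith
        _ ≤ (1 - η) * (c / X) := h9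
        _ = (1 - η) * c / X := by ring
        _ ≤ _ := h1
    · have : (1 - η - θ) * i ≤ 0 := mul_nonpos_of_nonpos_of_nonneg (by linarith) hi0
      linarith
  have := mul_le_mul_of_nonneg_right hsum hi0
  nlinarith

variable {n : ℕ}

/-- The two-round cipher as a keyed construction based on a single permutation. -/
def twoRoundBPEM (K : Fin 3 → Bits (n + n)) (f : Perm (Bits n)) : Perm (Bits (n + n)) :=
  BPEM 2 ![K 0, K 1, K 2] ![f, f]

open Classical in
-- An inequality is enough, since only a lower bound on the real probability is needed.
theorem card_connects_le (QE : Finset (Bits (n + n) × Bits (n + n)))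
    (Qf : Finset (Bits n × Bits n)) :
    #(((univ : Finset (Fin 6 → Bits n)) ×ˢ agreeing Qf).filter fun o =>
      Connects o.2 (fun e : QE => left e.1.1 + o.1 0) (fun e => right e.1.1 + o.1 1)
        (fun e => left e.1.2 + o.1 2) (fun e => right e.1.2 + o.1 3) (o.1 4) (o.1 5)) ≤
    #(((univ : Finset (Fin 3 → Bits (n + n))) ×ˢ agreeing Qf).filter fun z =>
      Agrees (twoRoundBPEM z.1 z.2) QE) := by
  refine card_le_card_of_injOn (fun o => (assembleKeys o.1, o.2)) ?_ ?_
  · intro o ho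
    obtain ⟨h1, h2⟩ := mem_filter.1 (mem_coe.1 ho)
    exact mem_coe.2 (mem_filter.2 ⟨mem_product.2 ⟨mem_univ _, (mem_product.1 h1).2⟩,
      agrees_BPEM_of_connects h2⟩)
  · intro o _ o' _ h
    exact Prod.ext (assembleKeys_injective (Prod.mk.inj h).1) (Prod.mk.inj h).2

theorem mass_idealWorld_le_mass_realWorld {p q : ℕ} (hpq : p * (21 * p + 8 * q) < 2 ^ n)
    (QE : Finset (Bits (n + n) × Bits (n + n))) (Qf : Finset (Bits n × Bits n))
    (hg : GoodTranscript QE) (hp : #QE ≤ p) (hq : #Qf ≤ q) :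
    mass (fun o => (idealWorld (n + n) n o).toReal) QE Qf (fun _ => True) ≤
      mass (fun o => (realWorld (twoRoundBPEM (n := n)) o).toReal) QE Qf (fun _ => True) +
        (6 * p * q + 18 * p ^ 2) / 2 ^ n *
          mass (fun o => (idealWorld (n + n) n o).toReal) QE Qf fun _ => True := by
  classical
  have hI0 : 0 ≤ mass (fun o => (idealWorld (n + n) n o).toReal) QE Qf fun _ => True :=
    mass_nonneg fun _ => ENNReal.toReal_nonneg
  rcases (agreeing QE).eq_empty_or_nonempty with hE | ⟨E, hE⟩
  · have h0 : mass (fun o => (idealWorld (n + n) n o).toReal) QE Qf (fun _ => True) = 0 := by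
      rw [mass_idealWorld, hE]
      simp
    rw [h0, mul_zero, add_zero]
    exact mass_nonneg fun _ => ENNReal.toReal_nonneg
  rw [mem_agreeing] at hE
  -- Without cipher pairs the masses agree exactly. This case is separate because `hpq` does not
  -- bound `q` when `p = 0`.
  rcases QE.eq_empty_or_nonempty with rfl | hne
  · have h0 : mass (fun o => (idealWorld (n + n) n o).toReal) ∅ Qf (fun _ => True) =
        mass (fun o => (realWorld (twoRoundBPEM (n := n)) o).toReal) ∅ Qf fun _ => True := by
      have h1 : (#(agreeing (∅ : Finset (Bits (n + n) × Bits (n + n)))) : ℝ) =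
          Fintype.card (Perm (Bits (n + n))) := by simp [agreeing, Agrees]
      rw [mass_idealWorld, mass_realWorld, h1, filter_true_of_mem (by simp [Agrees]),
        card_product, card_univ, Nat.cast_mul,
        mul_div_mul_left _ _ (by exact_mod_cast Fintype.card_ne_zero),
        mul_div_mul_left _ _ (by exact_mod_cast Fintype.card_ne_zero)]
    have h2 : (0 : ℝ) ≤ (6 * p * q + 18 * p ^ 2) / 2 ^ n := by positivity
    have := mul_nonneg h2 hI0
    linarith
  have hp1 : 1 ≤ #QE := hne.card_pos
  have hcG := card_bits n
  set N := 2 ^ n with hN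
  -- Since `p ≥ 1`, `hpq` yields `21 + 8q < N`, more than the needed `5(#Qf + 1) ≤ N`.
  have hQ : 4 * Fintype.card (Bits n) ≤ 5 * (Fintype.card (Bits n) - (#Qf + 1)) := by
    rw [hcG]
    have : q ≤ p * q := Nat.le_mul_of_pos_left q (by omega)
    have : 1 ≤ p * p := Nat.mul_pos (by omega) (by omega)
    have : p * (21 * p + 8 * q) = 21 * (p * p) + 8 * (p * q) := by ring
    omega
  have hval : ∀ e e' : QE, e ≠ e' → e.1 ≠ e'.1 := fun e e' h h' => h (Subtype.ext h')
  have hcore := card_mul_card_le_connects (fun e : QE => left e.1.1) (fun e => right e.1.1)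
    (fun e => left e.1.2) (fun e => right e.1.2) Qf hQ
    (fun e e' hee h1 h2 => by
      have h3 : e.1.1 = e'.1.1 := bits_ext h2 h1
      refine hval e e' hee (Prod.ext h3 ?_)
      rw [← hE e.1 e.2, ← hE e'.1 e'.2, h3])
    (fun e e' hee h1 h2 => by
      have h3 : e.1.2 = e'.1.2 := bits_ext h1 h2
      refine hval e e' hee (Prod.ext (E.injective ?_) h3)
      rw [hE e.1 e.2, hE e'.1 e'.2, h3])
    (fun e e' hee h1 h2 => hg e.1 e.2 e'.1 e'.2 (hval e e' hee) (Or.inr ⟨h1, h2⟩))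
    (fun e e' hee h1 h2 => hg e.1 e.2 e'.1 e'.2 (hval e e' hee) (Or.inl ⟨h1, h2⟩))
  have hR := card_connects_le QE Qf
  have hI := pow_mul_card_agreeing_le QE
  rw [mass_idealWorld, mass_realWorld]
  rw [card_bits] at hI
  rw [hcG, Fintype.card_coe, card_product, card_univ, Fintype.card_fun, hcG, Fintype.card_fin]
    at hcore
  have hK : Fintype.card (Fin 3 → Bits (n + n)) = N ^ 6 := by
    rw [Fintype.card_fun, card_bits, Fintype.card_fin, pow_add, ← hN]
    ring
  rw [hK]
  set cR := #(((univ : Finset (Fin 3 → Bits (n + n))) ×ˢ agreeing Qf).filter fun z =>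
      Agrees (twoRoundBPEM z.1 z.2) QE)
  set cC := #(((univ : Finset (Fin 6 → Bits n)) ×ˢ agreeing Qf).filter fun o =>
      Connects o.2 (fun e : QE => left e.1.1 + o.1 0) (fun e => right e.1.1 + o.1 1)
        (fun e => left e.1.2 + o.1 2) (fun e => right e.1.2 + o.1 3) (o.1 4) (o.1 5))
  set p' := #QE
  set q' := #Qf
  set a := #(agreeing QE)
  set c := #(agreeing Qf)
  set Y := Fintype.card (Perm (Bits (n + n)))
  set X := Fintype.card (Perm (Bits n))
  have hN1 : 1 ≤ N := Nat.one_le_two_pow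
  have hNR : ((2 : ℝ) ^ n) = (N : ℝ) := by rw [hN]; push_cast; rfl
  have hpN : p' ≤ 2 ^ (n + n) := by
    rw [pow_add, ← hN]
    nlinarith
  rw [hNR]
  refine ideal_le_real_of_counts (p := p) (q := q) (p' := p') (q' := q') p' rfl
    (by exact_mod_cast hN1) (by exact_mod_cast Fintype.card_pos)
    (by exact_mod_cast Fintype.card_pos) (by positivity) (by positivity) (by positivity)
    (by positivity) ?_ (by exact_mod_cast hp) (by exact_mod_cast hq) ?_ ?_ rfl (by positivity)
  · rw [pow_add, ← hN] at hpN
    exact_mod_cast hpN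
  · have h1 := hcore.trans (Nat.add_le_add_right (Nat.mul_le_mul_left N
      (Nat.mul_le_mul_left (N ^ (2 * p')) hR)) _)
    exact_mod_cast h1
  · have h1 : (((2 ^ (n + n) - p') ^ p' * a : ℕ) : ℝ) ≤ Y := by exact_mod_cast hI
    rw [Nat.cast_mul, Nat.cast_pow, Nat.cast_sub hpN, pow_add, ← hN, Nat.cast_mul] at h1
    exact h1

theorem advantage_twoRoundBPEM_le {p q : ℕ} (hpq : p * (21 * p + 8 * q) < 2 ^ n)
    (A : Adversary (n + n) n p q) :
    A.advantage (realWorld (twoRoundBPEM (n := n))) (idealWorld (n + n) n) ≤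
      (p : ℝ) * (21 * p + 8 * q) / 2 ^ n := by
  refine A.advantage_le _ _ (by positivity) fun s hs b => ?_
  have hpn : 21 * p ^ 2 < 2 ^ n := by nlinarith
  have h := mass_run_le (w := fun o => (idealWorld (n + n) n o).toReal)
    (w' := fun o => (realWorld (twoRoundBPEM (n := n)) o).toReal)
    (fun _ => ENNReal.toReal_nonneg) (fun _ => ENNReal.toReal_nonneg) GoodTranscript p q
    (ε := (6 * p * q + 18 * p ^ 2) / 2 ^ n) (δ := 2 * p / 2 ^ n) (by positivity) (by positivity)
    (fun QE Qf => mass_idealWorld_le_mass_realWorld hpq QE Qf)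
    (fun QE Qf x hg hp => sum_mass_idealWorld_le hpn _ (mul_sum_card_agreeing_enc_le hp hg x))
    (fun QE Qf y hg hp => sum_mass_idealWorld_le hpn (fun x => (x, y))
      (mul_sum_card_agreeing_dec_le hp hg y))
    b s ∅ ∅ 0 0 (fun e he => absurd he (notMem_empty e)) le_rfl le_rfl fun o _ => by
      have h1 := A.cipherQueries_le s hs o.1 o.2
      have h2 := A.permQueries_le s hs o.1 o.2
      omega
  rw [← toReal_map_run, ← toReal_map_run, mass_empty_true] at h
  refine h.trans (add_le_add_right ?_ _)
  rw [Nat.cast_zero, sub_zero, mul_one, div_mul_eq_mul_div, ← add_div]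
  gcongr
  -- The total `6pq + 18p² + 2p·p` is at most `21p² + 8pq`.
  nlinarith [mul_nonneg (Nat.cast_nonneg (α := ℝ) p) (Nat.cast_nonneg (α := ℝ) q),
    sq_nonneg (p : ℝ)]

end Main

end BPEMCipher

theorem mainTheorem5 (n : ℕ) (hn : 1 ≤ n) (qStar q : ℕ) :
    BPEMCipher.imSPRPAdvantage
        (fun (K : Fin 3 → BPEMCipher.Bits (n + n)) (f : Equiv.Perm (BPEMCipher.Bits n)) =>
          BPEMCipher.BPEM 2 ![K 0, K 1, K 2] ![f, f])
        qStar q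
      ≤ (qStar : ℝ) * (21 * (qStar : ℝ) + 8 * (q : ℝ)) / (2 : ℝ) ^ n := by
  refine ciSup_le fun A => ?_
  -- Otherwise the claimed bound is at least 1 and holds trivially.
  by_cases h : qStar * (21 * qStar + 8 * q) < 2 ^ n
  · exact BPEMCipher.advantage_twoRoundBPEM_le h A
  · refine (A.advantage_le_one _ _).trans ?_
    rw [one_le_div (by positivity)]
    exact_mod_cast not_lt.1 h
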